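/- Let $A$ be a commutative complex Banach algebra, let $\Omega_A$ be its maximal ideal space (the nonzero characters of $A$) with the Gelfand topology, and let $\widehat a$ denote the Gelfand transform of $a\in A$. The algebra $A$ is \emph{regular} if for every $x\in\Omega_A$ and every open neighbourhood $U$ of $x$ there is $a\in A$ with $\widehat a(x)=1$ and $\widehat a=0$ on $\Omega_A\setminus U$. It is \emph{Tauberian} if it is semisimple and the elements $a$ for which $\operatorname{supp}\widehat a$ is compact are dense in $A$. It satisfies \emph{condition $(M)$} if it is regular and, for all $x\in\Omega_A$, all $a\in A$ with $\widehat a(x)=0$ and all neighbourhoods $U$ of $x$, \[ \inf\{\|ba\| : b\in A,\ \widehat b\equiv 1 \text{ on some neighbourhood of } x,\ \operatorname{supp}\widehat b\subseteq U\}=0 . \] A \emph{convolution function algebra} over a locally compact (Hausdorff) group $G$ is a semisimple regular Tauberian commutative Banach algebra $A$ whose maximal ideal space is identified with $G$ by a homeomorphism, so that the elements of $A$ are continuous functions on $G$ with pointwise multiplication, and such that (i) for all $f,g\in A$ the convolution $(f*g)(x)=\int_G f(s)\,g(s^{-1}x)\,ds$ (left Haar measure) converges absolutely for every $x\in G$,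 and the function $f*g$ belongs to $A$; (ii) for all $f\in A$ and $x\in G$, the left translate $y\mapsto f(x^{-1}y)$ belongs to $A$. A linear map $T:A_1\to A_2$ between commutative Banach algebras is \emph{separating} if $ab=0$ implies $Ta\,Tb=0$. For $y\in\Omega_{A_2}$ such that $a\mapsto \widehat{Ta}(y)$ is not the zero functional, an open subset $V$ of the one-point compactification $\Omega_{A_1}\cup\{\infty\}$ is a \emph{vanishing set} for $y$ if $\widehat{Ta}(y)=0$ for all $a\in A_1$ with $\{x:\widehat a(x)\neq 0\}\subseteq V$. When the complement in $\Omega_{A_1}\cup\{\infty\}$ of the union of all vanishing sets for $y$ consists of a single point, this point is denoted by $t(y)$; the map $t$ is the \emph{support map} of $T$. \textbf{Theorem.} Let $A_1$ and $A_2$ be convolution function algebras over locally compact groups $G_1$ and $G_2$, both satisfying condition $(M)$. Let $T:A_1\to A_2$ be a bijective separating linear map that satisfies condition $(P)$: for all $f,g\in A_1$ and $y\in G_2$, if $T(f*g)(y)=0$, then $(Tf*Tg)(y)=0$. Then the support map $t$ of $T$ is defined at every point of $G_2$, takes its values in $G_1$, and is a topological group isomorphism from $G_2$ onto $G_1$,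 that is, a homeomorphism that is also a group isomorphism. -/

import Mathlib

open MeasureTheory WeakDual

namespace SepMaps

section BanachAlgebra

variable {A : Type*} [NonUnitalNormedCommRing A] [NormedSpace ℂ A]

/-- The Gelfand transform of `a`, as a function on the maximal ideal space
(the nonzero continuous characters with the weak-* topology). -/
noncomputable def gelfand (a : A) : characterSpace ℂ A → ℂ := fun φ => φ a

variable (A) in
/-- Semisimplicity: the characters have trivial common kernel. -/
def IsSemisimple : Prop := ∀ a : A, (∀ φ : characterSpace ℂ A, gelfand a φ = 0) → a = 0

variable (A) in
/-- Regularity of a commutative Banach algebra. -/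
def IsRegular : Prop :=
  ∀ (φ : characterSpace ℂ A) (U : Set (characterSpace ℂ A)), IsOpen U → φ ∈ U →
    ∃ a : A, gelfand a φ = 1 ∧ ∀ ψ, ψ ∉ U → gelfand a ψ = 0

variable (A) in
/-- The elements whose Gelfand transform has compact support are dense. Together with
semisimplicity this says that the algebra is Tauberian. -/
def HasDenseCompactlySupported : Prop :=
  Dense {a : A | HasCompactSupport (gelfand a)}

variable (A) in
/-- Semisimple regular Tauberian algebras. -/
structure IsRegularTauberian : Prop where
  semisimple : IsSemisimple A
  regular : IsRegular A
  dense_compactlySupported : HasDenseCompactlySupported A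

variable (A) in
/-- Condition (M): the algebra is regular, and whenever `a` vanishes at `φ` and `U` is a
neighbourhood of `φ`, the infimum of the norms `‖b * a‖`, over all `b` that are `1` on a
neighbourhood of `φ` and whose support is contained in `U`, is zero. -/
structure ConditionM : Prop where
  regular : IsRegular A
  inf_eq_zero : ∀ (φ : characterSpace ℂ A) (a : A), gelfand a φ = 0 →
    ∀ U ∈ nhds φ, ∀ ε : ℝ, 0 < ε →
      ∃ b : A, (∃ V ∈ nhds φ, ∀ ψ ∈ V, gelfand b ψ = 1) ∧ tsupport (gelfand b) ⊆ U ∧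
        ‖b * a‖ < ε

end BanachAlgebra

section Separating

variable {A B : Type*} [NonUnitalNormedCommRing A] [NormedSpace ℂ A]
  [NonUnitalNormedCommRing B] [NormedSpace ℂ B]

/-- Separating (disjointness preserving) linear maps. -/
def IsSeparating (T : A →ₗ[ℂ] B) : Prop := ∀ a b : A, a * b = 0 → T a * T b = 0

/-- The characters `y` of `B` for which the functional `a ↦ y (T a)` is not zero. This is the
domain of the support map. -/
def supportMapDomain (T : A →ₗ[ℂ] B) : Set (characterSpace ℂ B) :=
  {y | ∃ a : A, gelfand (T a) y ≠ 0}

/-- `V` is a vanishing set for the functional `a ↦ y (T a)`: it is open in the one-point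
compactification of the maximal ideal space of `A`, and the functional vanishes at every `a`
whose cozero set is contained in `V`. -/
def IsVanishingSet (T : A →ₗ[ℂ] B) (y : characterSpace ℂ B)
    (V : Set (OnePoint (characterSpace ℂ A))) : Prop :=
  IsOpen V ∧ ∀ a : A, (∀ φ : characterSpace ℂ A, gelfand a φ ≠ 0 → (φ : OnePoint _) ∈ V) →
    gelfand (T a) y = 0

/-- The support of the functional `a ↦ y (T a)`: the complement of the union of its vanishing
sets. -/
def functionalSupport (T : A →ₗ[ℂ] B) (y : characterSpace ℂ B) :
    Set (OnePoint (characterSpace ℂ A)) :=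
  (⋃₀ {V | IsVanishingSet T y V})ᶜ

end Separating

section Group

variable {G : Type*} [Group G] [MeasurableSpace G]

/-- Convolution of functions on a group, with respect to a left Haar measure `μ`. -/
noncomputable def conv (μ : Measure G) (u v : G → ℂ) (x : G) : ℂ :=
  ∫ s, u s * v (s⁻¹ * x) ∂μ

/-- The convolution integral is absolutely convergent at every point. -/
def ConvExists (μ : Measure G) (u v : G → ℂ) : Prop :=
  ∀ x : G, Integrable (fun s => u s * v (s⁻¹ * x)) μ

variable {A : Type*} [NonUnitalNormedCommRing A] [NormedSpace ℂ A] [TopologicalSpace G]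

/-- An element `f` of `A` as a function on `G`, where `e` identifies `G` with the maximal ideal
space of `A`. -/
noncomputable def toFun (e : G ≃ₜ characterSpace ℂ A) (f : A) : G → ℂ := fun x => gelfand f (e x)

/-- `A` is a convolution function algebra over `G`, where `e` identifies `G` with the maximal
ideal space of `A`, and `μ` is the Haar measure used for convolution. -/
structure IsConvolutionFunctionAlgebra (μ : Measure G) (e : G ≃ₜ characterSpace ℂ A) :
    Prop where
  regularTauberian : IsRegularTauberian A
  convExists : ∀ f g : A, ConvExists μ (toFun e f) (toFun e g)
  conv_mem : ∀ f g : A, ∃ h : A, toFun e h = conv μ (toFun e f) (toFun e g)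
  translate_mem : ∀ (f : A) (x : G), ∃ h : A, ∀ y : G, toFun e h y = toFun e f (x⁻¹ * y)

end Group

/-- Condition (P). The element `h` plays the role of the convolution product `f * g`
in `A₁`. -/
def ConditionP {G₁ G₂ A₁ A₂ : Type*} [Group G₁] [TopologicalSpace G₁] [MeasurableSpace G₁]
    [Group G₂] [TopologicalSpace G₂] [MeasurableSpace G₂]
    [NonUnitalNormedCommRing A₁] [NormedSpace ℂ A₁]
    [NonUnitalNormedCommRing A₂] [NormedSpace ℂ A₂]
    (μ₁ : Measure G₁) (μ₂ : Measure G₂)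
    (e₁ : G₁ ≃ₜ characterSpace ℂ A₁) (e₂ : G₂ ≃ₜ characterSpace ℂ A₂)
    (T : A₁ →ₗ[ℂ] A₂) : Prop :=
  ∀ f g h : A₁, toFun e₁ h = conv μ₁ (toFun e₁ f) (toFun e₁ g) →
    ∀ y : G₂, toFun e₂ (T h) y = 0 → conv μ₂ (toFun e₂ (T f)) (toFun e₂ (T g)) y = 0

end SepMaps

set_option linter.unusedSectionVars false

open Filter Topology
open scoped Pointwise

/-! The map `T` is first shown to be a weighted composition operator. Each functional `a ↦ y (T a)`
is local: separation leaves at most one point in its support, and compactness with local units gives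
at least one. Call the functional regular if its support is a finite point `x` and it kills every
`a` vanishing at `x`; it is then a multiple of evaluation at `x`. A gliding hump built from
condition (M) shows that non-regular functionals are supported at only finitely many finite points.
By Banach–Steinhaus, (M) and density of compact supports, the characters `y` with a regular
functional form a closed set. If some `y` were not regular, regularity of `A₂` and surjectivity
would give a nonzero `a` vanishing at the supports of all regular functionals. As support points are
dense, `a` would live on a finite set and hence on isolated points; but functionals supported at an
isolated point are regular. The inverse of `T` is separating too, so `t` is a homeomorphism
(`exists_supportMap_homeomorph`).

For multiplicativity, suppose `t (y * z) ≠ t y * t z` and choose neighbourhoods `U`, `V` of `t y`,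
`t z` with `t (y * z) ∉ U * V`. If `T f`, `T g` live on the preimages of `U`, `V`, then `f * g`
vanishes at `t (y * z)`, so (P) forces `(T f * T g) (y * z) = 0`. The contradiction needs functions
of `A₂` near `y` and `z` whose convolution does not vanish at `y * z`, and this reduces to an
element of `A₂` near `z` with nonzero integral (`exists_integral_translateProd_ne_zero`).

That is the hard point: `A₂` need not be closed under conjugation, so positivity is not available.
From a compactly supported local unit, written `c` after a translation, one can still form the
products `c * ∏ (1 - c (v⁻¹ * ·))`. Suppose all their integrals vanish. Drop points of the group at
random one after another, rejecting those too close to earlier ones, and follow the expectation of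
`∏ (1 - c (v⁻¹))`, the uncovered part at the identity. Moving the observation point instead of the
dropped point (mass transport) turns its rate of change into one of the vanishing integrals, so the
expectation stays near its initial value 1. But a point landing near the identity makes the product
0, so the expectation also decays exponentially. Points are drawn from a compact window, which
breaks translation invariance; the error is controlled by a summable weight that bounds how far the
influence of a point spreads, and this needs neither amenability nor unimodularity. -/

namespace SepMaps

/-! ### Random sequential adsorption on a group -/

section Adsorption

variable {G : Type*} [Group G]

/-- The product of the values `φ (v⁻¹ * s)` over the points `v` of the list `K`. -/
def translateProd {R : Type*} [Monoid R] (φ : G → R) (K : List G) (s : G) : R :=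
  (K.map fun v => φ (v⁻¹ * s)).prod

@[simp] lemma translateProd_nil {R : Type*} [Monoid R] (φ : G → R) (s : G) :
    translateProd φ [] s = 1 := rfl

@[simp] lemma translateProd_cons {R : Type*} [Monoid R] (φ : G → R) (v : G) (K : List G) (s : G) :
    translateProd φ (v :: K) s = φ (v⁻¹ * s) * translateProd φ K s := by
  simp [translateProd]

lemma translateProd_append_cons {R : Type*} [CommMonoid R] (φ : G → R) (L K : List G) (w s : G) :
    translateProd φ (L ++ w :: K) s = φ (w⁻¹ * s) * translateProd φ (L ++ K) s := by
  simp only [translateProd, List.map_append, List.map_cons, List.prod_append, List.prod_cons]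
  rw [mul_left_comm]

lemma translateProd_map {R : Type*} [Monoid R] (φ : G → R) (K : List G) (g s : G) :
    translateProd φ (K.map (g * ·)) (g * s) = translateProd φ K s := by
  simp [translateProd, Function.comp_def, mul_assoc]

/-- The probability that a point `u` is accepted in the presence of the points of `K`. -/
def avoid (θ : G → ℝ) (K : List G) (u : G) : ℝ := translateProd (fun x => 1 - θ x) K u

lemma translateProd_mem_Icc {φ : G → ℝ} (h0 : ∀ x, 0 ≤ φ x) (h1 : ∀ x, φ x ≤ 1) (K : List G)
    (u : G) : 0 ≤ translateProd φ K u ∧ translateProd φ K u ≤ 1 := by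
  induction K with
  | nil => simp
  | cons v K ih =>
    rw [translateProd_cons]
    exact ⟨mul_nonneg (h0 _) ih.1, mul_le_one₀ (h1 _) ih.1 ih.2⟩

/-- Lists whose points are separated in the sense prescribed by `θ`. -/
def Separated (θ : G → ℝ) (K : List G) : Prop := K.Pairwise fun u v => θ (v⁻¹ * u) ≠ 1

lemma ne_of_translateProd_ne_zero {R : Type*} [MonoidWithZero R] {φ : G → R} {K : List G} {u : G}
    (h : translateProd φ K u ≠ 0) : ∀ v ∈ K, φ (v⁻¹ * u) ≠ 0 := by
  intro v hv h0
  refine h (List.prod_eq_zero ?_)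
  exact List.mem_map.2 ⟨v, hv, h0⟩

/-- A point is accepted with positive probability only if no earlier point excludes it completely,
so the process started at `[]` visits separated lists only. Bounds are therefore needed on separated
lists alone. -/
lemma Separated.cons {θ : G → ℝ} {K : List G} (hK : Separated θ K) {u : G}
    (hu : avoid θ K u ≠ 0) : Separated θ (u :: K) := by
  refine List.pairwise_cons.2 ⟨fun v hv h => ?_, hK⟩
  exact ne_of_translateProd_ne_zero hu v hv (by simp [h])

lemma Separated.of_append_cons {θ : G → ℝ} {L K : List G} {w : G}
    (h : Separated θ (L ++ w :: K)) : Separated θ (L ++ K) :=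
  List.Pairwise.sublist ((List.Sublist.refl L).append (List.sublist_cons_self w K)) h

variable [TopologicalSpace G] [IsTopologicalGroup G]

lemma continuous_translateProd {R : Type*} [Monoid R] [TopologicalSpace R] [ContinuousMul R]
    {φ : G → R} (hφ : Continuous φ) :
    Continuous fun p : List G × G => translateProd φ p.1 p.2 := by
  rw [continuous_iff_continuousAt]
  rintro ⟨K, s⟩
  induction K with
  | nil =>
    simp only [ContinuousAt, nhds_prod_eq, nhds_nil, translateProd_nil]
    rw [Filter.pure_prod, Filter.tendsto_map'_iff]
    exact tendsto_const_nhds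
  | cons v K ih =>
    -- In the topology on lists, neighbourhoods of `v :: K` vary the head and the tail independently
    -- and keep the length.
    have e : 𝓝 (v :: K) ×ˢ 𝓝 s =
        ((𝓝 v ×ˢ 𝓝 K) ×ˢ 𝓝 s).map fun p : (G × List G) × G => (p.1.1 :: p.1.2, p.2) := by
      have : 𝓝 (v :: K) = (𝓝 v ×ˢ 𝓝 K).map fun p : G × List G => p.1 :: p.2 :=
        le_antisymm (by
          have := (List.tendsto_cons_iff (f := id) (a := v) (l := K)
            (b := (𝓝 v ×ˢ 𝓝 K).map fun p : G × List G => p.1 :: p.2)).2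
            (by simpa using Filter.tendsto_map)
          exact this) List.tendsto_cons
      conv_lhs => rw [this, ← Filter.map_id (f := 𝓝 s), Filter.prod_map_map_eq]
      rfl
    rw [ContinuousAt, nhds_prod_eq, e, Filter.tendsto_map'_iff]
    simp only [Function.comp_def, translateProd_cons]
    rw [ContinuousAt, nhds_prod_eq] at ih
    refine Tendsto.mul ?_ ?_
    · have : Tendsto (fun p : G × G => φ (p.1⁻¹ * p.2)) (𝓝 v ×ˢ 𝓝 s) (𝓝 (φ (v⁻¹ * s))) := by
        rw [← nhds_prod_eq]
        exact (by fun_prop : Continuous fun p : G × G => φ (p.1⁻¹ * p.2)).continuousAt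
      exact this.comp ((tendsto_fst.comp tendsto_fst).prodMk tendsto_snd)
    · exact ih.comp ((tendsto_snd.comp tendsto_fst).prodMk tendsto_snd)

lemma continuous_avoid {θ : G → ℝ} (hθ : Continuous θ) :
    Continuous fun p : List G × G => avoid θ p.1 p.2 :=
  continuous_translateProd (by fun_prop)

variable [MeasurableSpace G] [BorelSpace G] (μ : Measure G)

/-- One step of random sequential adsorption, acting on functions of the configuration `K`:
a point `u` is chosen with density `τ χ`, and it is added with probability `avoid θ K u`. -/
noncomputable def adsorb (χ θ : G → ℝ) (τ : ℝ) (h : List G → ℂ) (K : List G) : ℂ :=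
  h K + τ • ∫ u, (χ u * avoid θ K u) • (h (u :: K) - h K) ∂μ

variable {μ} {χ θ : G → ℝ} {τ : ℝ} {h : List G → ℂ}

lemma continuous_comp_cons {E : Type*} [TopologicalSpace E] {h : List G → E}
    (hh : Continuous h) (K : List G) : Continuous fun u : G => h (u :: K) :=
  hh.comp (List.continuous_cons.comp (by fun_prop : Continuous fun u : G => (u, K)))

lemma continuous_avoid_right (hθ : Continuous θ) (K : List G) : Continuous (avoid θ K) :=
  (continuous_avoid hθ).comp (by fun_prop : Continuous fun u : G => (K, u))

lemma integrable_window [IsFiniteMeasureOnCompacts μ] {E : Type*} [NormedAddCommGroup E]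
    [NormedSpace ℝ E] (hχ : Continuous χ) (hχs : HasCompactSupport χ) {a : G → ℝ}
    (ha : Continuous a) {F : G → E} (hF : Continuous F) :
    Integrable (fun u => (χ u * a u) • F u) μ := by
  refine Continuous.integrable_of_hasCompactSupport (by fun_prop) ?_
  exact (hχs.mul_right (f' := a)).smul_right

lemma continuous_adsorb [IsFiniteMeasureOnCompacts μ] {X : Type*} [TopologicalSpace X]
    (hχ : Continuous χ) (hχs : HasCompactSupport χ) (hθ : Continuous θ) {h : X → List G → ℂ}
    (hh : Continuous fun p : X × List G => h p.1 p.2) :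
    Continuous fun p : X × List G => adsorb μ χ θ τ (h p.1) p.2 := by
  unfold adsorb
  refine hh.add (Continuous.const_smul ?_ τ)
  rw [← continuousOn_univ]
  refine continuousOn_integral_of_compact_support (k := tsupport χ) hχs ?_ ?_
  · refine Continuous.continuousOn ?_
    refine Continuous.smul (f := fun p : (X × List G) × G => χ p.2 * avoid θ p.1.2 p.2)
      (g := fun p : (X × List G) × G => h p.1.1 (p.2 :: p.1.2) - h p.1.1 p.1.2) ?_ ?_
    · exact (hχ.comp continuous_snd).mul
        ((continuous_avoid hθ).comp ((continuous_snd.comp continuous_fst).prodMk continuous_snd))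
    · refine Continuous.sub ?_ (hh.comp continuous_fst)
      exact hh.comp ((continuous_fst.comp continuous_fst).prodMk
        (List.continuous_cons.comp (continuous_snd.prodMk (continuous_snd.comp continuous_fst))))
  · intro p u _ hu
    simp [image_eq_zero_of_notMem_tsupport hu]

lemma continuous_adsorb_iterate [IsFiniteMeasureOnCompacts μ] {X : Type*} [TopologicalSpace X]
    (hχ : Continuous χ) (hχs : HasCompactSupport χ) (hθ : Continuous θ) {h : X → List G → ℂ}
    (hh : Continuous fun p : X × List G => h p.1 p.2) (n : ℕ) :
    Continuous fun p : X × List G => (adsorb μ χ θ τ)^[n] (h p.1) p.2 := by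
  induction n with
  | zero => exact hh
  | succ n ih =>
    simp only [Function.iterate_succ_apply']
    exact continuous_adsorb (h := fun x => (adsorb μ χ θ τ)^[n] (h x)) hχ hχs hθ ih

lemma continuous_adsorb_iterate' [IsFiniteMeasureOnCompacts μ]
    (hχ : Continuous χ) (hχs : HasCompactSupport χ) (hθ : Continuous θ)
    (hh : Continuous h) (n : ℕ) : Continuous ((adsorb μ χ θ τ)^[n] h) :=
  (continuous_adsorb_iterate (X := Unit) (h := fun _ => h) hχ hχs hθ
    (hh.comp continuous_snd) n).comp (Continuous.prodMk continuous_const continuous_id :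
      Continuous fun K : List G => ((), K))

lemma adsorb_sub_smul [IsFiniteMeasureOnCompacts μ]
    (hχ : Continuous χ) (hχs : HasCompactSupport χ) (hθ : Continuous θ) {g h : List G → ℂ}
    (hg : Continuous g) (hh : Continuous h) (r : ℝ) :
    adsorb μ χ θ τ (g - r • h) = adsorb μ χ θ τ g - r • adsorb μ χ θ τ h := by
  funext K
  have I : ∀ f : List G → ℂ, Continuous f → Integrable
      (fun u => (χ u * avoid θ K u) • (f (u :: K) - f K)) μ := fun f hf =>
    integrable_window hχ hχs (continuous_avoid_right hθ K)
      ((continuous_comp_cons hf K).sub continuous_const)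
  simp only [adsorb, Pi.sub_apply, Pi.smul_apply]
  have : (fun u => (χ u * avoid θ K u) • (g (u :: K) - r • h (u :: K) - (g K - r • h K))) =
      fun u => (χ u * avoid θ K u) • (g (u :: K) - g K) -
        r • ((χ u * avoid θ K u) • (h (u :: K) - h K)) := by
    funext u
    simp only [Complex.real_smul]; ring
  have I2 : Integrable (fun u => r • ((χ u * avoid θ K u) • (h (u :: K) - h K))) μ :=
    (I h hh).smul r
  rw [this, integral_sub (I g hg) I2, integral_smul]
  simp only [Complex.real_smul]; ring

lemma adsorb_iterate_sub_smul [IsFiniteMeasureOnCompacts μ]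
    (hχ : Continuous χ) (hχs : HasCompactSupport χ) (hθ : Continuous θ) {g h : List G → ℂ}
    (hg : Continuous g) (hh : Continuous h) (r : ℝ) (n : ℕ) :
    (adsorb μ χ θ τ)^[n] (g - r • h) =
      (adsorb μ χ θ τ)^[n] g - r • (adsorb μ χ θ τ)^[n] h := by
  induction n with
  | zero => rfl
  | succ n ih =>
    simp only [Function.iterate_succ_apply']
    rw [ih, adsorb_sub_smul hχ hχs hθ (continuous_adsorb_iterate' hχ hχs hθ hg n)
      (continuous_adsorb_iterate' hχ hχs hθ hh n)]

/-- This is Fubini: expectation commutes with averaging a compactly weighted family of observables.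
-/
lemma adsorb_integral [IsFiniteMeasureOnCompacts μ]
    (hχ : Continuous χ) (hχs : HasCompactSupport χ) (hθ : Continuous θ) {ρ : G → ℂ}
    (hρ : Continuous ρ) (hρs : HasCompactSupport ρ) {h : G → List G → ℂ}
    (hh : Continuous fun p : G × List G => h p.1 p.2) (K : List G) :
    adsorb μ χ θ τ (fun K => ∫ x, ρ x * h x K ∂μ) K =
      ∫ x, ρ x * adsorb μ χ θ τ (h x) K ∂μ := by
  have hK : ∀ K, Continuous fun x => h x K := fun K =>
    hh.comp (continuous_id.prodMk continuous_const)
  have I : ∀ K, Integrable (fun x => ρ x * h x K) μ := fun K =>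
    (hρ.mul (hK K)).integrable_of_hasCompactSupport hρs.mul_right
  have hc : Continuous fun p : G × G => h p.1 (p.2 :: K) :=
    hh.comp (continuous_fst.prodMk (List.continuous_cons.comp
      (continuous_snd.prodMk continuous_const)))
  have hcK : Continuous fun p : G × G => h p.1 K := (hK K).comp continuous_fst
  have ha := continuous_avoid_right hθ K
  have hE : Continuous fun p : G × G => (χ p.2 * avoid θ K p.2) •
      (h p.1 (p.2 :: K) - h p.1 K) :=
    ((hχ.mul ha).comp continuous_snd).smul (hc.sub hcK)
  have hF : Continuous fun p : G × G => ρ p.1 * ((χ p.2 * avoid θ K p.2) •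
      (h p.1 (p.2 :: K) - h p.1 K)) := (hρ.comp continuous_fst).mul hE
  have hS : HasCompactSupport fun p : G × G => ρ p.1 * ((χ p.2 * avoid θ K p.2) •
      (h p.1 (p.2 :: K) - h p.1 K)) := by
    refine HasCompactSupport.intro (hρs.isCompact.prod hχs.isCompact) ?_
    rintro ⟨x, u⟩ hxu
    rcases not_and_or.1 (fun H => hxu (Set.mk_mem_prod H.1 H.2)) with H | H
    · simp [image_eq_zero_of_notMem_tsupport H]
    · simp [image_eq_zero_of_notMem_tsupport H]
  have swap := integral_integral_swap_of_hasCompactSupport (μ := μ) (ν := μ)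
    (f := fun x u => ρ x * ((χ u * avoid θ K u) • (h x (u :: K) - h x K))) hF hS
  simp only [adsorb]
  have e1 : ∀ u, (χ u * avoid θ K u) • ((∫ x, ρ x * h x (u :: K) ∂μ) - ∫ x, ρ x * h x K ∂μ) =
      ∫ x, ρ x * ((χ u * avoid θ K u) • (h x (u :: K) - h x K)) ∂μ := by
    intro u
    rw [← integral_sub (I _) (I _), ← integral_smul]
    congr 1; funext x
    simp only [Complex.real_smul]; ring
  simp only [e1]
  rw [← swap]
  have e2 : ∀ x, ∫ u, ρ x * ((χ u * avoid θ K u) • (h x (u :: K) - h x K)) ∂μ =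
      ρ x * ∫ u, (χ u * avoid θ K u) • (h x (u :: K) - h x K) ∂μ := fun x =>
    integral_const_mul _ _
  have hint : Integrable (fun x => ρ x * ∫ u, (χ u * avoid θ K u) •
      (h x (u :: K) - h x K) ∂μ) μ := by
    refine Continuous.integrable_of_hasCompactSupport (hρ.mul ?_) hρs.mul_right
    rw [← continuousOn_univ]
    refine continuousOn_integral_of_compact_support (k := tsupport χ) hχs ?_ ?_
    · exact Continuous.continuousOn hE
    · intro x u _ hu
      simp [image_eq_zero_of_notMem_tsupport hu]
  simp only [e2]
  have hint' : Integrable (fun x => τ • (ρ x * ∫ u, (χ u * avoid θ K u) •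
      (h x (u :: K) - h x K) ∂μ)) μ := hint.smul τ
  rw [← integral_smul, ← integral_add (I K) hint']
  congr 1; funext x
  simp only [Complex.real_smul]; ring

lemma adsorb_iterate_integral [IsFiniteMeasureOnCompacts μ]
    (hχ : Continuous χ) (hχs : HasCompactSupport χ) (hθ : Continuous θ) {ρ : G → ℂ}
    (hρ : Continuous ρ) (hρs : HasCompactSupport ρ) {h : G → List G → ℂ}
    (hh : Continuous fun p : G × List G => h p.1 p.2) (n : ℕ) :
    (adsorb μ χ θ τ)^[n] (fun K => ∫ x, ρ x * h x K ∂μ) =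
      fun K => ∫ x, ρ x * (adsorb μ χ θ τ)^[n] (h x) K ∂μ := by
  induction n with
  | zero => rfl
  | succ n ih =>
    simp only [Function.iterate_succ_apply']
    rw [ih]
    funext K
    exact adsorb_integral hχ hχs hθ hρ hρs (continuous_adsorb_iterate hχ hχs hθ hh n) K

/-- Acceptance depends only on the relative positions `v⁻¹ * u`, so the window is the only part of
the process that is not left invariant. -/
lemma adsorb_translate [μ.IsMulLeftInvariant] (g : G) (h : List G → ℂ) (K : List G) :
    adsorb μ (fun u => χ (g * u)) θ τ (fun K => h (K.map (g * ·))) K =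
      adsorb μ χ θ τ h (K.map (g * ·)) := by
  simp only [adsorb]
  congr 2
  rw [← integral_mul_left_eq_self (μ := μ)
    (fun u => (χ u * avoid θ (K.map (g * ·)) u) •
      (h (u :: K.map (g * ·)) - h (K.map (g * ·)))) g]
  simp only [avoid, translateProd_map, List.map_cons]

lemma adsorb_iterate_translate [μ.IsMulLeftInvariant] (g : G) (h : List G → ℂ) (n : ℕ) :
    (adsorb μ (fun u => χ (g * u)) θ τ)^[n] (fun K => h (K.map (g * ·))) =
      fun K => (adsorb μ χ θ τ)^[n] h (K.map (g * ·)) := by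
  induction n with
  | zero => rfl
  | succ n ih =>
    simp only [Function.iterate_succ_apply']
    rw [ih]
    funext K
    exact adsorb_translate g _ K

end Adsorption

/-! ### Contraction, influence of a point, and change of window -/

section AdsorptionBounds

variable {G : Type*} [Group G] [TopologicalSpace G] [IsTopologicalGroup G]
  [MeasurableSpace G] [BorelSpace G] {μ : Measure G} {χ θ : G → ℝ} {τ : ℝ} {h : List G → ℂ}

/-- A window for adsorption: continuous, compactly supported and normalized against `τ`. -/
structure IsWindow (μ : Measure G) (τ : ℝ) (χ : G → ℝ) : Prop where
  continuous : Continuous χ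
  hasCompactSupport : HasCompactSupport χ
  nonneg : ∀ x, 0 ≤ χ x
  le_one : ∀ x, χ x ≤ 1
  mass_le : τ * ∫ x, χ x ∂μ ≤ 1

/-- A cutoff describing hard-core exclusion. -/
structure IsCutoff (θ : G → ℝ) : Prop where
  continuous : Continuous θ
  hasCompactSupport : HasCompactSupport θ
  nonneg : ∀ x, 0 ≤ θ x
  le_one : ∀ x, θ x ≤ 1

lemma IsCutoff.avoid_mem (hθ : IsCutoff θ) (K : List G) (u : G) :
    0 ≤ avoid θ K u ∧ avoid θ K u ≤ 1 :=
  translateProd_mem_Icc (fun x => sub_nonneg.2 (hθ.le_one x))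
    (fun x => by simpa using hθ.nonneg x) K u

variable [IsFiniteMeasureOnCompacts μ]

lemma IsWindow.mass_avoid_le (hχ : IsWindow μ τ χ) (hτ : 0 ≤ τ) {a : G → ℝ} (ha : Continuous a)
    (ha1 : ∀ u, a u ≤ 1) : τ * ∫ u, χ u * a u ∂μ ≤ 1 := by
  refine le_trans (mul_le_mul_of_nonneg_left ?_ hτ) hχ.mass_le
  refine integral_mono ?_ ?_ fun u => mul_le_of_le_one_right (hχ.nonneg u) (ha1 u)
  · simpa using integrable_window (E := ℝ) (F := fun _ => (1 : ℝ)) hχ.continuous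
      hχ.hasCompactSupport ha continuous_const
  · exact hχ.continuous.integrable_of_hasCompactSupport hχ.hasCompactSupport

/-- The total acceptance probability is at most 1, so a step is a convex combination of staying at
`K` and moving to some `u :: K`; a majorant of `‖h‖` evolves as an expectation. -/
lemma norm_adsorb_le (hχ : IsWindow μ τ χ) (hθ : IsCutoff θ) (hτ : 0 ≤ τ) (hh : Continuous h)
    {g : List G → ℝ} (hg : Continuous g) (hle : ∀ K, Separated θ K → ‖h K‖ ≤ g K) {K : List G}
    (hK : Separated θ K) :
    ‖adsorb μ χ θ τ h K‖ ≤
      g K + τ * ∫ u, (χ u * avoid θ K u) * (g (u :: K) - g K) ∂μ := by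
  have ha := continuous_avoid_right hθ.continuous K
  have I1 : Integrable (fun u => (χ u * avoid θ K u) • h (u :: K)) μ :=
    integrable_window hχ.continuous hχ.hasCompactSupport ha (continuous_comp_cons hh K)
  have I2 : Integrable (fun u => (χ u * avoid θ K u) • h K) μ :=
    integrable_window hχ.continuous hχ.hasCompactSupport ha continuous_const
  have I3 : Integrable (fun u => (χ u * avoid θ K u) * g (u :: K)) μ :=
    integrable_window hχ.continuous hχ.hasCompactSupport ha (continuous_comp_cons hg K)
  have I4 : Integrable (fun u => (χ u * avoid θ K u) * g K) μ :=
    integrable_window hχ.continuous hχ.hasCompactSupport ha continuous_const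
  have hm := hχ.mass_avoid_le hτ ha fun u => (hθ.avoid_mem K u).2
  have e : adsorb μ χ θ τ h K = (1 - τ * ∫ u, χ u * avoid θ K u ∂μ) • h K +
      τ • ∫ u, (χ u * avoid θ K u) • h (u :: K) ∂μ := by
    simp only [adsorb, smul_sub]
    rw [integral_sub I1 I2, integral_smul_const]
    simp only [Complex.real_smul]
    push_cast
    ring
  have e' : g K + τ * ∫ u, (χ u * avoid θ K u) * (g (u :: K) - g K) ∂μ =
      (1 - τ * ∫ u, χ u * avoid θ K u ∂μ) * g K +
        τ * ∫ u, (χ u * avoid θ K u) * g (u :: K) ∂μ := by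
    simp only [mul_sub]
    rw [integral_sub I3 I4, integral_mul_const]
    ring
  rw [e, e']
  refine (norm_add_le _ _).trans (add_le_add ?_ ?_)
  · rw [norm_smul, Real.norm_of_nonneg (by linarith)]
    exact mul_le_mul_of_nonneg_left (hle K hK) (by linarith)
  · rw [norm_smul, Real.norm_of_nonneg hτ]
    refine mul_le_mul_of_nonneg_left ?_ hτ
    refine norm_integral_le_of_norm_le I3 (ae_of_all _ fun u => ?_)
    rw [norm_smul, Real.norm_of_nonneg (mul_nonneg (hχ.nonneg u) (hθ.avoid_mem K u).1)]
    rcases eq_or_ne (avoid θ K u) 0 with h0 | h0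
    · simp [h0]
    · exact mul_le_mul_of_nonneg_left (hle _ (hK.cons h0))
        (mul_nonneg (hχ.nonneg u) (hθ.avoid_mem K u).1)

lemma norm_adsorb_iterate_le (hχ : IsWindow μ τ χ) (hθ : IsCutoff θ) (hτ : 0 ≤ τ)
    (hh : Continuous h) {C : ℝ} (hle : ∀ K, Separated θ K → ‖h K‖ ≤ C) (n : ℕ) {K : List G}
    (hK : Separated θ K) : ‖(adsorb μ χ θ τ)^[n] h K‖ ≤ C := by
  induction n generalizing K with
  | zero => exact hle K hK
  | succ n ih =>
    rw [Function.iterate_succ_apply']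
    simpa using norm_adsorb_le hχ hθ hτ
      (continuous_adsorb_iterate' hχ.continuous hχ.hasCompactSupport hθ.continuous hh n)
      (g := fun _ => C) continuous_const (fun K hK => ih hK) hK

/-- `B w` bounds the influence of the point `w` on the value of `h`. -/
def InfluenceLE (θ : G → ℝ) (h : List G → ℂ) (B : G → ℝ) : Prop :=
  ∀ (L K : List G) (w : G), Separated θ (L ++ w :: K) → ‖h (L ++ w :: K) - h (L ++ K)‖ ≤ B w

/-- Couple the processes with and without `w` by using the same proposal `u`. Either both treat `u`
alike and still differ by `w` alone, or `w` blocks `u` and they then differ by the influence of `u`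
too. The second case is weighted by `θ (w⁻¹ * u)`, which gives the term `τ * lam * B w`. -/
lemma influenceLE_adsorb (hχ : IsWindow μ τ χ) (hθ : IsCutoff θ) (hτ : 0 ≤ τ) (hh : Continuous h)
    {B : G → ℝ} (hB : Continuous B) (hB0 : ∀ u, 0 ≤ B u) {lam : ℝ}
    (hlam : ∀ w, ∫ u, χ u * θ (w⁻¹ * u) * B u ∂μ ≤ lam * B w) (hinf : InfluenceLE θ h B) :
    InfluenceLE θ (adsorb μ χ θ τ h) fun w => (1 + τ * lam) * B w := by
  intro L K w hLK
  have hLK0 := hLK.of_append_cons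
  set K1 := L ++ w :: K with hK1
  set K0 := L ++ K with hK0
  set a : G → ℝ := avoid θ K0 with ha_def
  set t : G → ℝ := fun u => θ (w⁻¹ * u) with ht_def
  have ha : Continuous a := continuous_avoid_right hθ.continuous K0
  have ht : Continuous t := hθ.continuous.comp (by fun_prop)
  have ha0 : ∀ u, 0 ≤ a u := fun u => (hθ.avoid_mem K0 u).1
  have ha1 : ∀ u, a u ≤ 1 := fun u => (hθ.avoid_mem K0 u).2
  have ht0 : ∀ u, 0 ≤ t u := fun u => hθ.nonneg _
  have ht1 : ∀ u, t u ≤ 1 := fun u => hθ.le_one _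
  have haK1 : ∀ u, avoid θ K1 u = a u * (1 - t u) := by
    intro u
    rw [ha_def, avoid, hK1, translateProd_append_cons, mul_comm]
    rfl
  have hb : Continuous fun u => a u * (1 - t u) := by fun_prop
  have hat : Continuous fun u => a u * t u := by fun_prop
  have hc1 := continuous_comp_cons hh K1
  have hc0 := continuous_comp_cons hh K0
  have I1 : Integrable (fun u => (χ u * (a u * (1 - t u))) • (h (u :: K1) - h (u :: K0))) μ :=
    integrable_window hχ.continuous hχ.hasCompactSupport hb (hc1.sub hc0)
  have I2 : Integrable (fun u => (χ u * (a u * (1 - t u))) • (h K1 - h K0)) μ :=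
    integrable_window hχ.continuous hχ.hasCompactSupport hb continuous_const
  have I3 : Integrable (fun u => (χ u * (a u * t u)) • (h (u :: K0) - h K0)) μ :=
    integrable_window hχ.continuous hχ.hasCompactSupport hat (hc0.sub continuous_const)
  have J1 : Integrable (fun u => (χ u * (a u * (1 - t u))) • (h (u :: K1) - h K1)) μ :=
    integrable_window hχ.continuous hχ.hasCompactSupport hb (hc1.sub continuous_const)
  have J2 : Integrable (fun u => (χ u * a u) • (h (u :: K0) - h K0)) μ :=
    integrable_window hχ.continuous hχ.hasCompactSupport ha (hc0.sub continuous_const)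
  have hm := hχ.mass_avoid_le hτ hb fun u => by nlinarith [ha0 u, ha1 u, ht0 u, ht1 u]
  have I12 : Integrable (fun u => (χ u * (a u * (1 - t u))) • (h (u :: K1) - h (u :: K0)) -
      (χ u * (a u * (1 - t u))) • (h K1 - h K0)) μ := I1.sub I2
  -- The acceptance probability `a` without `w` splits into `a * (1 - t)`, where both lists accept,
  -- and `a * t`, where only the list without `w` does.
  have key : (∫ u, (χ u * (a u * (1 - t u))) • (h (u :: K1) - h K1) ∂μ) -
      ∫ u, (χ u * a u) • (h (u :: K0) - h K0) ∂μ =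
      (∫ u, (χ u * (a u * (1 - t u))) • (h (u :: K1) - h (u :: K0)) ∂μ) -
      (∫ u, χ u * (a u * (1 - t u)) ∂μ) • (h K1 - h K0) -
      ∫ u, (χ u * (a u * t u)) • (h (u :: K0) - h K0) ∂μ := by
    rw [← integral_smul_const, ← integral_sub J1 J2, ← integral_sub I1 I2,
      ← integral_sub I12 I3]
    congr 1; funext u
    simp only [Complex.real_smul]
    push_cast
    ring
  have e : adsorb μ χ θ τ h K1 - adsorb μ χ θ τ h K0 =
      (1 - τ * ∫ u, χ u * (a u * (1 - t u)) ∂μ) • (h K1 - h K0) +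
      τ • (∫ u, (χ u * (a u * (1 - t u))) • (h (u :: K1) - h (u :: K0)) ∂μ) -
      τ • ∫ u, (χ u * (a u * t u)) • (h (u :: K0) - h K0) ∂μ := by
    have : adsorb μ χ θ τ h K1 - adsorb μ χ θ τ h K0 = (h K1 - h K0) +
      τ • ((∫ u, (χ u * (a u * (1 - t u))) • (h (u :: K1) - h K1) ∂μ) -
      ∫ u, (χ u * a u) • (h (u :: K0) - h K0) ∂μ) := by
      simp only [adsorb, haK1, ← ha_def, smul_sub]
      ring
    rw [this, key]
    simp only [Complex.real_smul]
    push_cast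
    ring
  have N1 : ‖∫ u, (χ u * (a u * (1 - t u))) • (h (u :: K1) - h (u :: K0)) ∂μ‖ ≤
      (∫ u, χ u * (a u * (1 - t u)) ∂μ) * B w := by
    rw [← integral_mul_const]
    refine norm_integral_le_of_norm_le ?_ (ae_of_all _ fun u => ?_)
    · exact integrable_window hχ.continuous hχ.hasCompactSupport hb continuous_const
    have hpos : 0 ≤ χ u * (a u * (1 - t u)) :=
      mul_nonneg (hχ.nonneg u) (mul_nonneg (ha0 u) (sub_nonneg.2 (ht1 u)))
    rw [norm_smul, Real.norm_of_nonneg hpos]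
    rcases eq_or_ne (avoid θ K1 u) 0 with h0 | h0
    · rw [← haK1, h0]; simp
    · exact mul_le_mul_of_nonneg_left (hinf (u :: L) K w (hLK.cons h0)) hpos
  have N2 : ‖∫ u, (χ u * (a u * t u)) • (h (u :: K0) - h K0) ∂μ‖ ≤ lam * B w := by
    refine le_trans ?_ (hlam w)
    refine norm_integral_le_of_norm_le ?_ (ae_of_all _ fun u => ?_)
    · exact integrable_window hχ.continuous hχ.hasCompactSupport ht hB
    have hpos : 0 ≤ χ u * (a u * t u) :=
      mul_nonneg (hχ.nonneg u) (mul_nonneg (ha0 u) (ht0 u))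
    rw [norm_smul, Real.norm_of_nonneg hpos]
    rcases eq_or_ne (avoid θ K0 u) 0 with h0 | h0
    · rw [ha_def, h0]
      simpa using mul_nonneg (mul_nonneg (hχ.nonneg u) (ht0 u)) (hB0 u)
    · refine mul_le_mul ?_ (hinf [] K0 u (hLK0.cons h0)) (norm_nonneg _)
        (mul_nonneg (hχ.nonneg u) (ht0 u))
      exact mul_le_mul_of_nonneg_left (mul_le_of_le_one_left (ht0 u) (ha1 u)) (hχ.nonneg u)
  rw [e]
  refine (norm_sub_le _ _).trans ?_
  have := norm_add_le ((1 - τ * ∫ u, χ u * (a u * (1 - t u)) ∂μ) • (h K1 - h K0))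
    (τ • (∫ u, (χ u * (a u * (1 - t u))) • (h (u :: K1) - h (u :: K0)) ∂μ))
  rw [norm_smul, norm_smul, Real.norm_of_nonneg (by linarith), Real.norm_of_nonneg hτ] at this
  rw [norm_smul, Real.norm_of_nonneg hτ]
  have := mul_le_mul_of_nonneg_left (hinf L K w hLK)
    (sub_nonneg.2 hm)
  have := mul_le_mul_of_nonneg_left N1 hτ
  have := mul_le_mul_of_nonneg_left N2 hτ
  simp only [← hK1, ← hK0] at *
  nlinarith

lemma influenceLE_adsorb_iterate (hχ : IsWindow μ τ χ) (hθ : IsCutoff θ) (hτ : 0 ≤ τ)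
    (hh : Continuous h) {B : G → ℝ} (hB : Continuous B) (hB0 : ∀ u, 0 ≤ B u) {lam : ℝ}
    (hlam0 : 0 ≤ lam) (hlam : ∀ w, ∫ u, χ u * θ (w⁻¹ * u) * B u ∂μ ≤ lam * B w)
    (hinf : InfluenceLE θ h B) (n : ℕ) :
    InfluenceLE θ ((adsorb μ χ θ τ)^[n] h) fun w => (1 + τ * lam) ^ n * B w := by
  induction n with
  | zero => simpa using hinf
  | succ n ih =>
    rw [Function.iterate_succ_apply']
    have hpos : 0 ≤ (1 + τ * lam) ^ n := by positivity
    have := influenceLE_adsorb hχ hθ hτ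
      (continuous_adsorb_iterate' hχ.continuous hχ.hasCompactSupport hθ.continuous hh n)
      (B := fun w => (1 + τ * lam) ^ n * B w) (by fun_prop)
      (fun u => mul_nonneg hpos (hB0 u)) (lam := lam) (fun w => ?_) ih
    · convert this using 2
      ring
    · have e : ∀ u, χ u * θ (w⁻¹ * u) * ((1 + τ * lam) ^ n * B u) =
          (1 + τ * lam) ^ n * (χ u * θ (w⁻¹ * u) * B u) := fun u => by ring
      simp only [e]
      rw [integral_const_mul]
      nlinarith [hlam w]

/-- The windows are exchanged one step at a time. Each exchange costs `τ * ∫ |χ - χ'| * B`, enlarged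
by the growth of influence over the other steps. -/
lemma norm_adsorb_iterate_sub_le {χ' : G → ℝ} (hχ : IsWindow μ τ χ) (hχ' : IsWindow μ τ χ')
    (hθ : IsCutoff θ) (hτ : 0 ≤ τ)
    (hh : Continuous h) {B : G → ℝ} (hB : Continuous B) (hB0 : ∀ u, 0 ≤ B u) {lam : ℝ}
    (hlam0 : 0 ≤ lam) (hlam : ∀ w, ∫ u, χ u * θ (w⁻¹ * u) * B u ∂μ ≤ lam * B w)
    (hinf : InfluenceLE θ h B) {η : ℝ} (hη : ∫ u, |χ u - χ' u| * B u ∂μ ≤ η) (n : ℕ) {K : List G}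
    (hK : Separated θ K) :
    ‖(adsorb μ χ θ τ)^[n] h K - (adsorb μ χ' θ τ)^[n] h K‖ ≤
      n * (τ * ((1 + τ * lam) ^ n * η)) := by
  have hη0 : 0 ≤ η := le_trans (integral_nonneg fun u => mul_nonneg (abs_nonneg _) (hB0 u)) hη
  induction n generalizing K with
  | zero => simp
  | succ n ih =>
    simp only [Function.iterate_succ_apply']
    set f := (adsorb μ χ θ τ)^[n] h
    set f' := (adsorb μ χ' θ τ)^[n] h
    have hf : Continuous f :=
      continuous_adsorb_iterate' hχ.continuous hχ.hasCompactSupport hθ.continuous hh n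
    have hf' : Continuous f' :=
      continuous_adsorb_iterate' hχ'.continuous hχ'.hasCompactSupport hθ.continuous hh n
    have h1 : ‖adsorb μ χ' θ τ (f - (1 : ℝ) • f') K‖ ≤ n * (τ * ((1 + τ * lam) ^ n * η)) := by
      have := norm_adsorb_iterate_le (h := f - (1 : ℝ) • f') hχ' hθ hτ (by
        rw [one_smul]; exact hf.sub hf')
        (C := n * (τ * ((1 + τ * lam) ^ n * η))) (fun K hK => by simpa using ih hK) 1 hK
      simpa only [Function.iterate_one] using this
    rw [adsorb_sub_smul hχ'.continuous hχ'.hasCompactSupport hθ.continuous hf hf'] at h1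
    have ha := continuous_avoid_right hθ.continuous K
    have I : ∀ {χ₀ : G → ℝ}, IsWindow μ τ χ₀ →
        Integrable (fun u => (χ₀ u * avoid θ K u) • (f (u :: K) - f K)) μ := fun h₀ =>
      integrable_window h₀.continuous h₀.hasCompactSupport ha
        ((continuous_comp_cons hf K).sub continuous_const)
    have h2 : ‖adsorb μ χ θ τ f K - adsorb μ χ' θ τ f K‖ ≤ τ * ((1 + τ * lam) ^ n * η) := by
      have : adsorb μ χ θ τ f K - adsorb μ χ' θ τ f K =
          τ • ∫ u, ((χ u - χ' u) * avoid θ K u) • (f (u :: K) - f K) ∂μ := by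
        have e : ∀ u, ((χ u - χ' u) * avoid θ K u) • (f (u :: K) - f K) =
          (χ u * avoid θ K u) • (f (u :: K) - f K) -
          (χ' u * avoid θ K u) • (f (u :: K) - f K) := fun u => by
          simp only [Complex.real_smul]; push_cast; ring
        simp only [e]
        rw [integral_sub (I hχ) (I hχ')]
        simp only [adsorb, Complex.real_smul]
        ring
      rw [this, norm_smul, Real.norm_of_nonneg hτ]
      refine mul_le_mul_of_nonneg_left ?_ hτ
      have hpos : 0 ≤ (1 + τ * lam) ^ n := by positivity
      refine le_trans ?_ (mul_le_mul_of_nonneg_left hη hpos)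
      rw [← integral_const_mul]
      refine norm_integral_le_of_norm_le ?_ (ae_of_all _ fun u => ?_)
      · refine Integrable.const_mul ?_ _
        refine Continuous.integrable_of_hasCompactSupport ?_ ?_
        · exact (hχ.continuous.sub hχ'.continuous).abs.mul hB
        · have : HasCompactSupport fun u => |χ u - χ' u| :=
            (hχ.hasCompactSupport.sub hχ'.hasCompactSupport).comp_left
              (g := fun x : ℝ => |x|) abs_zero
          exact this.mul_right
      · rw [norm_smul, norm_mul, Real.norm_eq_abs, Real.norm_of_nonneg (hθ.avoid_mem K u).1]
        rcases eq_or_ne (avoid θ K u) 0 with h0 | h0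
        · rw [h0]
          simpa using mul_nonneg hpos (mul_nonneg (abs_nonneg _) (hB0 u))
        · have := influenceLE_adsorb_iterate hχ hθ hτ hh hB hB0 hlam0 hlam hinf n [] K u
            (hK.cons h0)
          simp only [List.nil_append] at this
          calc |χ u - χ' u| * avoid θ K u * ‖f (u :: K) - f K‖
              ≤ |χ u - χ' u| * 1 * ((1 + τ * lam) ^ n * B u) := by
                gcongr
                exact (hθ.avoid_mem K u).2
            _ = _ := by ring
    -- Telescoping: a contraction applied to the previous difference, plus one step with the wrong
    -- window applied to `f`.
    have e : adsorb μ χ θ τ f K - adsorb μ χ' θ τ f' K =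
        (adsorb μ χ' θ τ f - (1 : ℝ) • adsorb μ χ' θ τ f') K +
        (adsorb μ χ θ τ f K - adsorb μ χ' θ τ f K) := by
      simp
    rw [e]
    refine (norm_add_le _ _).trans ?_
    have mono : (1 + τ * lam) ^ n ≤ (1 + τ * lam) ^ (n + 1) :=
      pow_le_pow_right₀ (by nlinarith) (Nat.le_succ n)
    calc _ ≤ n * (τ * ((1 + τ * lam) ^ n * η)) + τ * ((1 + τ * lam) ^ n * η) := add_le_add h1 h2
      _ = (n + 1) * (τ * ((1 + τ * lam) ^ n * η)) := by ring
      _ ≤ ((n + 1 : ℕ) : ℝ) * (τ * ((1 + τ * lam) ^ (n + 1) * η)) := by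
        push_cast
        gcongr

end AdsorptionBounds

/-! ### Weights that control the spread of influence -/

section Weight

variable {G : Type*} [Group G] [TopologicalSpace G] [IsTopologicalGroup G]
  [MeasurableSpace G] [BorelSpace G] {μ : Measure G}

/-- Averaging against a kernel `θ (w⁻¹ * u)`, up to the factor `c`. -/
noncomputable def spread (μ : Measure G) (c : ℝ) (θ f : G → ℝ) (w : G) : ℝ :=
  c * ∫ u, θ (w⁻¹ * u) * f u ∂μ

/-- Nonnegative continuous functions with compact support. -/
structure IsBump (f : G → ℝ) : Prop where
  continuous : Continuous f
  hasCompactSupport : HasCompactSupport f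
  nonneg : ∀ x, 0 ≤ f x

variable [IsFiniteMeasureOnCompacts μ]

lemma IsBump.integrable {f : G → ℝ} (hf : IsBump f) : Integrable f μ :=
  hf.continuous.integrable_of_hasCompactSupport hf.hasCompactSupport

lemma IsBump.spread [T2Space G] {θ f : G → ℝ} (hθ : IsBump θ) (hf : IsBump f) {c : ℝ}
    (hc : 0 ≤ c) : IsBump (spread μ c θ f) where
  continuous := by
    refine Continuous.mul continuous_const ?_
    rw [← continuousOn_univ]
    refine continuousOn_integral_of_compact_support (k := tsupport f) hf.hasCompactSupport ?_ ?_
    · refine Continuous.continuousOn ?_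
      have := hθ.continuous
      have := hf.continuous
      change Continuous fun p : G × G => θ (p.1⁻¹ * p.2) * f p.2
      fun_prop
    · intro p u _ hu
      simp [image_eq_zero_of_notMem_tsupport hu]
  hasCompactSupport := by
    refine HasCompactSupport.intro
      (hf.hasCompactSupport.isCompact.mul hθ.hasCompactSupport.isCompact.inv) fun w hw => ?_
    have : ∀ u, θ (w⁻¹ * u) * f u = 0 := by
      intro u
      by_contra h
      have h1 := subset_tsupport θ (Function.mem_support.2 (left_ne_zero_of_mul h))
      have h2 := subset_tsupport f (Function.mem_support.2 (right_ne_zero_of_mul h))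
      refine hw ⟨u, h2, (w⁻¹ * u)⁻¹, by simpa using h1, by simp⟩
    simp [SepMaps.spread, this]
  nonneg w := mul_nonneg hc (integral_nonneg fun u => mul_nonneg (hθ.nonneg _) (hf.nonneg _))

lemma IsBump.comp_inv_mul {θ : G → ℝ} (hθ : IsBump θ) (w : G) :
    IsBump fun u => θ (w⁻¹ * u) where
  continuous := hθ.continuous.comp (by fun_prop)
  hasCompactSupport := hθ.hasCompactSupport.comp_homeomorph (Homeomorph.mulLeft w⁻¹)
  nonneg _ := hθ.nonneg _

lemma spread_le [μ.IsMulLeftInvariant] {θ f : G → ℝ} (hθ : IsBump θ) (hf : IsBump f) {c S : ℝ}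
    (hc : 0 ≤ c) (hS : ∀ x, f x ≤ S) (w : G) :
    spread μ c θ f w ≤ c * (∫ u, θ u ∂μ) * S := by
  rw [spread, mul_assoc]
  refine mul_le_mul_of_nonneg_left ?_ hc
  rw [← integral_mul_left_eq_self (μ := μ) θ w⁻¹, ← integral_mul_const]
  have h := hθ.comp_inv_mul w
  refine integral_mono ?_ (h.integrable.mul_const S) fun u =>
    mul_le_mul_of_nonneg_left (hS u) (hθ.nonneg _)
  exact (h.continuous.mul hf.continuous).integrable_of_hasCompactSupport
    h.hasCompactSupport.mul_right

lemma integral_spread [μ.IsMulLeftInvariant] {θ f : G → ℝ} (hθ : IsBump θ) (hf : IsBump f)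
    (c : ℝ) : ∫ w, spread μ c θ f w ∂μ = c * (∫ u, θ u⁻¹ ∂μ) * ∫ u, f u ∂μ := by
  simp only [spread]
  rw [integral_const_mul, mul_assoc]
  congr 1
  have hc1 := hθ.continuous
  have hc2 := hf.continuous
  rw [integral_integral_swap_of_hasCompactSupport (f := fun w u => θ (w⁻¹ * u) * f u)]
  · have : ∀ u, ∫ w, θ (w⁻¹ * u) * f u ∂μ = (∫ w, θ w⁻¹ ∂μ) * f u := by
      intro u
      rw [integral_mul_const, ← integral_mul_left_eq_self (μ := μ) (fun w => θ w⁻¹) u⁻¹]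
      simp
    simp only [this]
    rw [integral_const_mul]
  · change Continuous fun p : G × G => θ (p.1⁻¹ * p.2) * f p.2
    fun_prop
  · have hcp := (hf.hasCompactSupport.isCompact.prod hθ.hasCompactSupport.isCompact).image
      (f := fun p : G × G => (p.1 * p.2⁻¹, p.1)) (by fun_prop)
    refine HasCompactSupport.of_support_subset_isCompact hcp ?_
    rintro ⟨w, u⟩ h
    have h : θ (w⁻¹ * u) * f u ≠ 0 := h
    refine ⟨(u, w⁻¹ * u), ⟨subset_tsupport f (right_ne_zero_of_mul h),
      subset_tsupport θ (left_ne_zero_of_mul h)⟩, by simp⟩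

/-- A continuous weight which dominates `q`, is almost invariant under the kernel `θ`, and has
small mass outside of compact sets. -/
lemma exists_weight [T2Space G] [μ.IsMulLeftInvariant] {θ q : G → ℝ} (hθ : IsBump θ)
    (hq : IsBump q) :
    ∃ (Λ : G → ℝ) (lam : ℝ), 0 ≤ lam ∧ Continuous Λ ∧ (∀ x, 0 ≤ Λ x) ∧ (∀ x, q x ≤ Λ x) ∧
      (∀ w, ∫ u, θ (w⁻¹ * u) * Λ u ∂μ ≤ lam * Λ w) ∧
      ∀ ε > 0, ∃ E : Set G, IsCompact E ∧ ∀ ψ : G → ℝ, IsBump ψ → (∀ x, ψ x ≤ 1) →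
        (∀ x ∈ E, ψ x = 0) → ∫ u, ψ u * Λ u ∂μ ≤ ε := by
  set a := ∫ u, θ u ∂μ
  set b := ∫ u, θ u⁻¹ ∂μ
  have ha : 0 ≤ a := integral_nonneg hθ.nonneg
  have hb : 0 ≤ b := integral_nonneg fun u => hθ.nonneg _
  -- Suprema are multiplied by at most `a` and masses by `b`, which may differ when the group is not
  -- unimodular. Dividing by `lam > a + b` makes the iterates `F n` decay geometrically in both
  -- senses; the weight is their sum.
  set lam := a + b + 1
  have hlam : 0 < lam := by positivity
  set r := lam⁻¹ * (a + b)
  have hr0 : 0 ≤ r := by positivity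
  have hr1 : r < 1 := by
    rw [inv_mul_lt_iff₀ hlam]; simp [lam]
  set F : ℕ → G → ℝ := fun n => (spread μ lam⁻¹ θ)^[n] q
  have hFs : ∀ n, F (n + 1) = spread μ lam⁻¹ θ (F n) := fun n =>
    Function.iterate_succ_apply' _ _ _
  have hF : ∀ n, IsBump (F n) := by
    intro n
    induction n with
    | zero => exact hq
    | succ n ih => rw [hFs]; exact hθ.spread ih (by positivity)
  obtain ⟨S, hS⟩ := hq.hasCompactSupport.exists_bound_of_continuous hq.continuous
  have hS0 : 0 ≤ S := (norm_nonneg _).trans (hS 1)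
  have hFS : ∀ n x, F n x ≤ r ^ n * S := by
    intro n
    induction n with
    | zero => intro x; simpa [F] using (Real.le_norm_self _).trans (hS x)
    | succ n ih =>
      intro x
      rw [hFs]
      refine (spread_le hθ (hF n) (by positivity) ih x).trans ?_
      rw [pow_succ', mul_assoc r]
      refine mul_le_mul_of_nonneg_right ?_ (by positivity)
      exact mul_le_mul_of_nonneg_left (by linarith) (by positivity)
  set Q := ∫ u, q u ∂μ
  have hQ0 : 0 ≤ Q := integral_nonneg hq.nonneg
  have hFQ : ∀ n, ∫ u, F n u ∂μ ≤ r ^ n * Q := by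
    intro n
    induction n with
    | zero => simp [F, Q]
    | succ n ih =>
      rw [hFs, integral_spread hθ (hF n), pow_succ', mul_assoc r]
      refine mul_le_mul ?_ ih (integral_nonneg (hF n).nonneg) hr0
      exact mul_le_mul_of_nonneg_left (by linarith) (by positivity)
  have hgeo : Summable fun n : ℕ => r ^ n := summable_geometric_of_lt_one hr0 hr1
  have hsum : ∀ x, Summable fun n => F n x := fun x =>
    Summable.of_nonneg_of_le (fun n => (hF n).nonneg x) (fun n => hFS n x) (hgeo.mul_right S)
  have hΛ0 : ∀ x, 0 ≤ ∑' n, F n x := fun x => tsum_nonneg fun n => (hF n).nonneg x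
  have hinter : ∀ g : G → ℝ, IsBump g → (∃ C, ∀ x, g x ≤ C) →
      HasSum (fun n => ∫ u, g u * F n u ∂μ) (∫ u, g u * ∑' n, F n u ∂μ) := by
    rintro g hg ⟨C, hC⟩
    have hi : ∀ n, Integrable (fun u => g u * F n u) μ := fun n =>
      (hg.continuous.mul (hF n).continuous).integrable_of_hasCompactSupport
        hg.hasCompactSupport.mul_right
    have := hasSum_integral_of_summable_integral_norm hi ?_
    · simpa only [tsum_mul_left] using this
    · refine Summable.of_nonneg_of_le (fun n => integral_nonneg fun _ => norm_nonneg _)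
        (fun n => ?_) ((hgeo.mul_right Q).mul_left C)
      refine le_trans ?_ (mul_le_mul_of_nonneg_left (hFQ n) ((hg.nonneg 1).trans (hC 1)))
      rw [← integral_const_mul]
      refine integral_mono (hi n).norm ((hF n).integrable.const_mul C) fun u => ?_
      simp only
      rw [Real.norm_of_nonneg (mul_nonneg (hg.nonneg u) ((hF n).nonneg u))]
      exact mul_le_mul_of_nonneg_right (hC u) ((hF n).nonneg u)
  refine ⟨fun x => ∑' n, F n x, lam, hlam.le, ?_, hΛ0, ?_, ?_, ?_⟩
  · refine continuous_tsum (fun n => (hF n).continuous) (hgeo.mul_right S) fun n x => ?_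
    rw [Real.norm_of_nonneg ((hF n).nonneg x)]
    exact hFS n x
  · intro x
    exact (hsum x).le_tsum 0 fun n _ => (hF n).nonneg x
  · intro w
    obtain ⟨C, hC⟩ := hθ.hasCompactSupport.exists_bound_of_continuous hθ.continuous
    have h := hinter _ (hθ.comp_inv_mul w) ⟨C, fun x => (Real.le_norm_self _).trans (hC _)⟩
    rw [← h.tsum_eq]
    -- Applying the kernel shifts the series by one term, up to the factor `lam`; the missing term
    -- `F 0` is nonnegative.
    have e : ∀ n, ∫ u, θ (w⁻¹ * u) * F n u ∂μ = lam * F (n + 1) w := by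
      intro n
      rw [hFs, spread, mul_inv_cancel_left₀ hlam.ne']
    simp only [e]
    rw [tsum_mul_left]
    refine mul_le_mul_of_nonneg_left ?_ hlam.le
    rw [(hsum w).tsum_eq_zero_add]
    exact le_add_of_nonneg_left ((hF 0).nonneg w)
  · intro ε hε
    have ht := tendsto_sum_nat_add fun n : ℕ => r ^ n * Q
    -- The first `J` terms have compact support, whose union is the exceptional set; the remaining
    -- ones have total mass below `ε`.
    obtain ⟨J, hJ⟩ := (ht.eventually (gt_mem_nhds hε)).exists
    refine ⟨⋃ n ∈ Finset.range J, tsupport (F n),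
      (Finset.range J).isCompact_biUnion fun n _ => (hF n).hasCompactSupport, ?_⟩
    intro ψ hψ hψ1 hψE
    have h := hinter ψ hψ ⟨1, hψ1⟩
    rw [← h.tsum_eq, ← h.summable.sum_add_tsum_nat_add J]
    have z : ∑ n ∈ Finset.range J, ∫ u, ψ u * F n u ∂μ = 0 := by
      refine Finset.sum_eq_zero fun n hn => ?_
      rw [integral_eq_zero_of_ae (ae_of_all _ fun u => ?_)]
      simp only [Pi.zero_apply]
      by_cases hu : u ∈ tsupport (F n)
      · rw [hψE u (Set.mem_biUnion hn hu), zero_mul]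
      · rw [image_eq_zero_of_notMem_tsupport hu, mul_zero]
    rw [z, zero_add]
    refine le_trans ?_ hJ.le
    refine Summable.tsum_le_tsum (fun n => ?_) ((summable_nat_add_iff J).2 h.summable)
      ((summable_nat_add_iff J).2 (hgeo.mul_right Q))
    refine le_trans ?_ (hFQ (n + J))
    refine integral_mono ?_ (hF _).integrable fun u =>
      mul_le_of_le_one_left ((hF _).nonneg u) (hψ1 u)
    exact (hψ.continuous.mul (hF _).continuous).integrable_of_hasCompactSupport
        hψ.hasCompactSupport.mul_right

end Weight

/-! ### Packing bound for separated lists -/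

section Counting

variable {G : Type*} [Group G] [TopologicalSpace G] [IsTopologicalGroup G]

/-- Separated lists have uniformly boundedly many points near any given point. -/
lemma exists_norm_translateProd_le {θ : G → ℝ} (hθ : ∀ᶠ x in 𝓝 (1 : G), θ x = 1) {φ : G → ℂ}
    {C : ℝ} (hC : 1 ≤ C) (hφ : ∀ x, ‖φ x‖ ≤ C) {W : Set G} (hW : IsCompact W)
    (hφW : ∀ x ∉ W, φ x = 1) :
    ∃ M : ℝ, 0 < M ∧ ∀ K s, Separated θ K → ‖translateProd φ K s‖ ≤ M := by
  classical
  have h1 : ∀ᶠ p : G × G in 𝓝 (1, 1), θ (p.1 * p.2⁻¹) = 1 := by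
    have : Tendsto (fun p : G × G => p.1 * p.2⁻¹) (𝓝 (1, 1)) (𝓝 1) := by
      have := (by fun_prop : Continuous fun p : G × G => p.1 * p.2⁻¹).tendsto (1, 1)
      simpa using this
    exact this.eventually hθ
  rw [nhds_prod_eq] at h1
  obtain ⟨D, hD, hDθ⟩ := Filter.eventually_prod_self_iff'.1 h1
  have hcov : ∀ x ∈ W, {y | y * x⁻¹ ∈ D} ∈ 𝓝 x := by
    intro x _
    have : Tendsto (fun y => y * x⁻¹) (𝓝 x) (𝓝 1) := by
      have := (by fun_prop : Continuous fun y : G => y * x⁻¹).tendsto x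
      simpa using this
    exact this hD
  obtain ⟨t, -, ht⟩ := hW.elim_nhds_subcover _ hcov
  have hne : ∀ y : G, ∃ x : G, y ∈ W → x ∈ t ∧ y * x⁻¹ ∈ D := by
    intro y
    by_cases hy : y ∈ W
    · obtain ⟨x, hx, hxy⟩ := Set.mem_iUnion₂.1 (ht hy)
      exact ⟨x, fun _ => ⟨hx, hxy⟩⟩
    · exact ⟨1, fun h => absurd h hy⟩
  choose ι hι using hne
  -- Only points with `v⁻¹ * s ∈ W` contribute a factor other than 1. Two of them in the same
  -- translate `D * x` would satisfy `θ (v⁻¹ * u) = 1`, so there are at most `t.card`, whatever `s`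
  -- is.
  refine ⟨C ^ t.card, by positivity, fun K s hK => ?_⟩
  have hbound : ‖translateProd φ K s‖ ≤ C ^ (K.filter fun v => v⁻¹ * s ∈ W).length := by
    clear hK
    induction K with
    | nil => simp
    | cons v K ih =>
      rw [translateProd_cons, norm_mul]
      by_cases hv : v⁻¹ * s ∈ W
      · rw [List.filter_cons_of_pos (by simpa using hv), List.length_cons, pow_succ']
        exact mul_le_mul (hφ _) ih (norm_nonneg _) (by positivity)
      · rw [List.filter_cons_of_neg (by simpa using hv), hφW _ hv]
        simpa using ih
  refine hbound.trans (pow_le_pow_right₀ hC ?_)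
  set K' := K.filter fun v => v⁻¹ * s ∈ W
  have hK' : K'.Pairwise fun u v => θ (v⁻¹ * u) ≠ 1 := List.Pairwise.filter _ hK
  have hmem : ∀ v ∈ K', v⁻¹ * s ∈ W := fun v hv => by
    simpa using (List.mem_filter.1 hv).2
  have hnodup : (K'.map fun v => ι (v⁻¹ * s)).Nodup := by
    rw [List.nodup_iff_pairwise_ne, List.pairwise_map]
    refine List.Pairwise.imp_of_mem (fun {u v} hu hv huv h => huv ?_) hK'
    have h2 := (hι _ (hmem u hu)).2
    have h3 := (hι _ (hmem v hv)).2
    rw [h] at h2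
    have := hDθ _ h3 _ h2
    rw [← this]
    congr 1
    group
  have hsub : (K'.map fun v => ι (v⁻¹ * s)).toFinset ⊆ t := by
    intro x hx
    obtain ⟨v, hv, rfl⟩ := List.mem_map.1 (List.mem_toFinset.1 hx)
    exact (hι _ (hmem v hv)).1
  have := Finset.card_le_card hsub
  rwa [List.toFinset_card_of_nodup hnodup, List.length_map] at this

end Counting

/-! ### Mass transport and the nonvanishing integral -/

section MassTransport

variable {G : Type*} [Group G] [TopologicalSpace G] [IsTopologicalGroup G]

lemma IsCutoff.isBump {θ : G → ℝ} (hθ : IsCutoff θ) : IsBump θ :=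
  ⟨hθ.continuous, hθ.hasCompactSupport, hθ.nonneg⟩

lemma exists_isCutoff_of_isCompact [LocallyCompactSpace G] {k U : Set G} (hk : IsCompact k)
    (hU : IsOpen U) (hkU : k ⊆ U) :
    ∃ κ : G → ℝ, IsCutoff κ ∧ (∀ x ∈ k, κ x = 1) ∧ ∀ x ∉ U, κ x = 0 := by
  obtain ⟨f, h1, h0, hs, hf⟩ := exists_continuous_one_zero_of_isCompact hk hU.isClosed_compl
    (Set.disjoint_compl_right_iff_subset.2 hkU)
  exact ⟨f, ⟨f.continuous, hs, fun x => (hf x).1, fun x => (hf x).2⟩, fun x hx => h1 hx,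
    fun x hx => h0 hx⟩

lemma exists_isCutoff [LocallyCompactSpace G] {U : Set G} (hU : U ∈ 𝓝 (1 : G)) :
    ∃ κ : G → ℝ, IsCutoff κ ∧ (∀ᶠ x in 𝓝 1, κ x = 1) ∧ ∀ x ∉ U, κ x = 0 := by
  obtain ⟨k, hk, hkU, hkc⟩ := local_compact_nhds (interior_mem_nhds.2 hU)
  obtain ⟨κ, h, h1, h0⟩ := exists_isCutoff_of_isCompact hkc isOpen_interior hkU
  exact ⟨κ, h, Filter.mem_of_superset hk h1, fun x hx => h0 x fun h => hx (interior_subset h)⟩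

variable [LocallyCompactSpace G] [T2Space G] [MeasurableSpace G] [BorelSpace G]
  {μ : Measure G} [μ.IsHaarMeasure]

lemma IsWindow.comp_mul {χ : G → ℝ} {τ : ℝ} (hχ : IsWindow μ τ χ) (g : G) :
    IsWindow μ τ fun u => χ (g * u) where
  continuous := hχ.continuous.comp (by fun_prop)
  hasCompactSupport := hχ.hasCompactSupport.comp_homeomorph (Homeomorph.mulLeft g)
  nonneg _ := hχ.nonneg _
  le_one _ := hχ.le_one _
  mass_le := by rw [integral_mul_left_eq_self (μ := μ) χ g]; exact hχ.mass_le

/-- The product of the acceptance probability at `u` and of the uncovered part at `s`. -/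
noncomputable def testFun (θ : G → ℝ) (φ : G → ℂ) (u s : G) (K : List G) : ℂ :=
  avoid θ K u * translateProd φ K s

/-- This exchanges the dropped point and the observation point: after translation, dropping at `u`
and observing at `1` becomes dropping at `1` and observing at `u⁻¹`. -/
lemma testFun_map (θ : G → ℝ) (φ : G → ℂ) (u : G) :
    (fun K => testFun θ φ u 1 (K.map (u * ·))) = testFun θ φ 1 u⁻¹ := by
  funext K
  have h1 := translateProd_map (fun x => 1 - θ x) K u 1
  have h2 := translateProd_map φ K u u⁻¹
  rw [mul_one] at h1
  rw [mul_inv_cancel] at h2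
  rw [testFun, testFun, avoid, avoid, h1, h2]

lemma continuous_testFun {θ : G → ℝ} (hθ : Continuous θ) {φ : G → ℂ} (hφ : Continuous φ)
    {X : Type*} [TopologicalSpace X] {a b : X → G} (ha : Continuous a) (hb : Continuous b) :
    Continuous fun p : X × List G => testFun θ φ (a p.1) (b p.1) p.2 := by
  refine (Complex.continuous_ofReal.comp ?_).mul ?_
  · exact (continuous_avoid hθ).comp (continuous_snd.prodMk (ha.comp continuous_fst))
  · exact (continuous_translateProd hφ).comp (continuous_snd.prodMk (hb.comp continuous_fst))

lemma continuous_testFun' {θ : G → ℝ} (hθ : Continuous θ) {φ : G → ℂ} (hφ : Continuous φ)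
    (u s : G) : Continuous (testFun θ φ u s) :=
  (continuous_testFun hθ hφ (X := Unit) (a := fun _ => u) (b := fun _ => s) continuous_const
    continuous_const).comp (Continuous.prodMk continuous_const continuous_id :
      Continuous fun K : List G => ((), K))

lemma continuous_translateProd_left {R : Type*} [Monoid R] [TopologicalSpace R] [ContinuousMul R]
    {φ : G → R} (hφ : Continuous φ) (s : G) : Continuous fun K => translateProd φ K s :=
  (continuous_translateProd hφ).comp (continuous_id.prodMk continuous_const)

/-- Points far away have no influence on the test functions. -/
lemma exists_influence_bound {θ : G → ℝ} (hθ : IsCutoff θ) (hθ1 : ∀ᶠ x in 𝓝 (1 : G), θ x = 1)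
    {c : G → ℂ} (hc : Continuous c) (hcs : HasCompactSupport c) :
    ∃ q : G → ℝ, IsBump q ∧
      ∀ s ∈ tsupport c, InfluenceLE θ (testFun θ (fun x => 1 - c x) 1 s) q := by
  obtain ⟨S, hS⟩ := hcs.exists_bound_of_continuous hc
  have hS0 : 0 ≤ S := (norm_nonneg _).trans (hS 1)
  have hφ : ∀ x, ‖1 - c x‖ ≤ 1 + S := fun x =>
    (norm_sub_le _ _).trans (by simpa using hS x)
  obtain ⟨M, hM0, hM⟩ := exists_norm_translateProd_le hθ1 (by linarith) hφ hcs.isCompact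
    (fun x hx => by simp [image_eq_zero_of_notMem_tsupport hx])
  -- A point `w` outside this compact set changes neither factor of the test function when `s ∈
  -- tsupport c`.
  obtain ⟨q, hq, hq1, -⟩ := exists_isCutoff_of_isCompact
    (hθ.hasCompactSupport.isCompact.inv.union (hcs.isCompact.mul hcs.isCompact.inv))
    isOpen_univ (Set.subset_univ _)
  refine ⟨fun x => (M * (2 + S)) * q x, ⟨by have := hq.continuous; fun_prop,
    hq.hasCompactSupport.mul_left, fun x => mul_nonneg (by positivity) (hq.nonneg x)⟩, ?_⟩
  intro s hs L K w hLK
  have e : testFun θ (fun x => 1 - c x) 1 s (L ++ w :: K) -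
      testFun θ (fun x => 1 - c x) 1 s (L ++ K) =
      testFun θ (fun x => 1 - c x) 1 s (L ++ K) *
        (((1 - θ w⁻¹ : ℝ) : ℂ) * (1 - c (w⁻¹ * s)) - 1) := by
    simp only [testFun, avoid, translateProd_append_cons, mul_one]
    push_cast
    ring
  rw [e, norm_mul]
  have hf : ‖testFun θ (fun x => 1 - c x) 1 s (L ++ K)‖ ≤ M := by
    rw [testFun, norm_mul, Complex.norm_real, Real.norm_of_nonneg (hθ.avoid_mem _ _).1]
    calc _ ≤ 1 * ‖translateProd (fun x => 1 - c x) (L ++ K) s‖ := by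
          gcongr; exact (hθ.avoid_mem _ _).2
      _ ≤ M := by rw [one_mul]; exact hM _ _ hLK.of_append_cons
  by_cases h : θ w⁻¹ = 0 ∧ c (w⁻¹ * s) = 0
  · rw [h.1, h.2]
    simpa using mul_nonneg (by positivity) (hq.nonneg w)
  · have hw : q w = 1 := by
      refine hq1 w ?_
      rcases not_and_or.1 h with h | h
      · left
        exact subset_tsupport θ h
      · right
        refine ⟨s, hs, (w⁻¹ * s)⁻¹, ?_, by simp⟩
        rw [Set.inv_mem_inv]
        exact subset_tsupport c h
    show _ ≤ M * (2 + S) * q w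
    rw [hw, mul_one]
    refine mul_le_mul hf ?_ (norm_nonneg _) hM0.le
    refine (norm_sub_le _ _).trans ?_
    rw [norm_mul, Complex.norm_real, norm_one]
    have h1 : ‖1 - θ w⁻¹‖ ≤ 1 := by
      rw [Real.norm_eq_abs, abs_le]
      constructor <;> linarith [hθ.nonneg w⁻¹, hθ.le_one w⁻¹]
    nlinarith [hφ (w⁻¹ * s), norm_nonneg (1 - c (w⁻¹ * s)), norm_nonneg (1 - θ w⁻¹)]

/-- Under adsorption, the uncovered part at the identity decays exponentially. -/
lemma norm_adsorb_iterate_uncovered_le {θ κ κ₀ χ : G → ℝ} {τ M : ℝ} (hθ : IsCutoff θ)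
    (hκ : IsCutoff κ) (hκ₀ : IsCutoff κ₀) (hχ : IsWindow μ τ χ) (hτ : 0 ≤ τ) (hM : 0 ≤ M)
    {c : G → ℂ} (hc : Continuous c) {O : Set G}
    (hκc : ∀ x, κ x ≠ 0 → c x = 1) (hO1 : (1 : G) ∈ O)
    (hO : ∀ x ∈ O, ∀ y ∈ O, κ (x * y) = 1) (hθO : ∀ x ∉ O, θ x = 0)
    (hκ₀O : ∀ x ∉ O, κ₀ x = 0) (hχ1 : ∀ u, c u⁻¹ ≠ 0 → χ u = 1)
    (hbound : ∀ K, Separated θ K → ‖translateProd (fun x => 1 - c x) K 1‖ ≤ M) (n : ℕ)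
    {K : List G} (hK : Separated θ K) :
    ‖(adsorb μ χ θ τ)^[n] (fun K => translateProd (fun x => 1 - c x) K 1) K‖ ≤
      M * (1 - τ * ∫ u, κ₀ u⁻¹ ∂μ) ^ n * translateProd (fun x => 1 - κ x) K 1 := by
  have hφ : Continuous fun x => 1 - c x := by fun_prop
  have hκ' : Continuous fun x => 1 - κ x := by have := hκ.continuous; fun_prop
  have hU : ∀ K, 0 ≤ translateProd (fun x => 1 - κ x) K 1 := fun K =>
    (hκ.avoid_mem K 1).1
  have hOκ : ∀ x ∈ O, κ x = 1 := fun x hx => by simpa using hO x hx 1 hO1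
  have hOχ : ∀ u, u⁻¹ ∈ O → χ u = 1 := fun u hu => hχ1 u (by
    rw [hκc _ (by rw [hOκ _ hu]; exact one_ne_zero)]; exact one_ne_zero)
  have hκ₀inv : Integrable (fun u => κ₀ u⁻¹) μ := by
    refine Continuous.integrable_of_hasCompactSupport (hκ₀.continuous.comp continuous_inv) ?_
    exact hκ₀.hasCompactSupport.comp_homeomorph (Homeomorph.inv G)
  have hδ : τ * ∫ u, κ₀ u⁻¹ ∂μ ≤ 1 := by
    refine le_trans (mul_le_mul_of_nonneg_left ?_ hτ) hχ.mass_le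
    refine integral_mono hκ₀inv
      (hχ.continuous.integrable_of_hasCompactSupport hχ.hasCompactSupport) fun u => ?_
    by_cases hu : u⁻¹ ∈ O
    · simpa only [hOχ u hu] using hκ₀.le_one _
    · simpa only [hκ₀O _ hu] using hχ.nonneg u
  induction n generalizing K with
  | zero =>
    simp only [Function.iterate_zero, id, pow_zero, mul_one]
    -- If the product is not 1, some point has `κ (v⁻¹) ≠ 0`, hence `c (v⁻¹) = 1`, and the left side
    -- vanishes.
    by_cases h : translateProd (fun x => 1 - κ x) K 1 = 1
    · rw [h, mul_one]; exact hbound K hK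
    · have : ∃ v ∈ K, κ (v⁻¹ * 1) ≠ 0 := by
        by_contra hcon
        push Not at hcon
        refine h (List.prod_eq_one fun x hx => ?_)
        obtain ⟨v, hv, rfl⟩ := List.mem_map.1 hx
        simp only [hcon v hv, sub_zero]
      obtain ⟨v, hv, hκv⟩ := this
      have h0 : translateProd (fun x => 1 - c x) K 1 = 0 :=
        List.prod_eq_zero (List.mem_map.2 ⟨v, hv, by
          show 1 - c (v⁻¹ * 1) = 0
          rw [hκc _ hκv, sub_self]⟩)
      rw [h0, norm_zero]
      exact mul_nonneg hM (hU K)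
  | succ n ih =>
    rw [Function.iterate_succ_apply']
    set A := M * (1 - τ * ∫ u, κ₀ u⁻¹ ∂μ) ^ n with hA
    have hA0 : 0 ≤ A := mul_nonneg hM (pow_nonneg (sub_nonneg.2 hδ) n)
    refine (norm_adsorb_le hχ hθ hτ
      (continuous_adsorb_iterate' hχ.continuous hχ.hasCompactSupport hθ.continuous
        (continuous_translateProd_left hφ 1) n)
      (g := fun K => A * translateProd (fun x => 1 - κ x) K 1)
      (continuous_const.mul (continuous_translateProd_left hκ' 1))
      (fun K hK => ih hK) hK).trans ?_
    have e : ∀ u, χ u * avoid θ K u * (A * translateProd (fun x => 1 - κ x) (u :: K) 1 -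
        A * translateProd (fun x => 1 - κ x) K 1) =
        -(A * translateProd (fun x => 1 - κ x) K 1) * (χ u * avoid θ K u * κ u⁻¹) := by
      intro u
      rw [translateProd_cons, mul_one]; ring
    simp only [e]
    rw [integral_const_mul, pow_succ, ← mul_assoc M, ← hA]
    rcases eq_or_ne (translateProd (fun x => 1 - κ x) K 1) 0 with h0 | h0
    · simp [h0]
    · have hle : ∫ u, κ₀ u⁻¹ ∂μ ≤ ∫ u, χ u * avoid θ K u * κ u⁻¹ ∂μ := by
        refine integral_mono hκ₀inv (integrable_window hχ.continuous hχ.hasCompactSupport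
          (continuous_avoid_right hθ.continuous K) (hκ.continuous.comp continuous_inv))
          fun u => ?_
        simp only
        by_cases hu : u⁻¹ ∈ O
        -- While the `κ`-product at 1 is nonzero, no earlier point can block `u`: with `v⁻¹ * u` and
        -- `u⁻¹` both in `O`, the factor at `v` would be `1 - κ (v⁻¹) = 0`. Proposals near the
        -- identity are thus always accepted.
        · have : avoid θ K u = 1 := by
            refine List.prod_eq_one fun x hx => ?_
            obtain ⟨v, hv, rfl⟩ := List.mem_map.1 hx
            have : v⁻¹ * u ∉ O := by
              intro hvu
              refine ne_of_translateProd_ne_zero h0 v hv ?_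
              have := hO _ hvu _ hu
              rw [show v⁻¹ * u * u⁻¹ = v⁻¹ * 1 by group] at this
              simp only [this, sub_self]
            simp only [hθO _ this, sub_zero]
          rw [this, hOχ u hu, hOκ _ hu]
          simpa using hκ₀.le_one _
        · rw [hκ₀O _ hu]
          exact mul_nonneg (mul_nonneg (hχ.nonneg u) (hθ.avoid_mem K u).1) (hκ.nonneg _)
      have h1 := mul_le_mul_of_nonneg_left hle
        (mul_nonneg hτ (mul_nonneg hA0 (hU K)))
      linarith

lemma continuous_adsorb_iterate_left {χ θ : G → ℝ} {τ : ℝ} (hχ : Continuous χ)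
    (hχs : HasCompactSupport χ) (hθ : Continuous θ) {h : G → List G → ℂ}
    (hh : Continuous fun p : G × List G => h p.1 p.2) (n : ℕ) (K : List G) :
    Continuous fun u => (adsorb μ χ θ τ)^[n] (h u) K :=
  (continuous_adsorb_iterate (μ := μ) (τ := τ) hχ hχs hθ hh n).comp
    (g := fun p : G × List G => (adsorb μ χ θ τ)^[n] (h p.1) p.2) (f := fun u : G => (u, K))
    (continuous_id.prodMk continuous_const)

/-- A single step of adsorption changes the expected uncovered part only through the influence of
far away points, if all the integrals of the products of `c` with `translateProd` vanish. -/
lemma norm_adsorb_iterate_succ_sub_le {θ χ : G → ℝ} {τ : ℝ} (hθ : IsCutoff θ)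
    (hχ : IsWindow μ τ χ) (hτ : 0 ≤ τ) {c : G → ℂ} (hc : Continuous c)
    (hcs : HasCompactSupport c) (hχ1 : ∀ u, c u⁻¹ ≠ 0 → χ u = 1)
    (hint : ∀ K, ∫ r, c r⁻¹ * translateProd (fun x => 1 - c x) K r⁻¹ ∂μ = 0)
    {Λ : G → ℝ} (hΛ : Continuous Λ) (hΛ0 : ∀ u, 0 ≤ Λ u) {lam : ℝ} (hlam0 : 0 ≤ lam)
    (hlam : ∀ w, ∫ u, χ u * θ (w⁻¹ * u) * Λ u ∂μ ≤ lam * Λ w)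
    (hinf : ∀ s ∈ tsupport c, InfluenceLE θ (testFun θ (fun x => 1 - c x) 1 s) Λ) {η : ℝ}
    (hη : ∀ g, g⁻¹ ∈ tsupport c → ∫ u, |χ u - χ (g * u)| * Λ u ∂μ ≤ η) (n : ℕ) :
    ‖(adsorb μ χ θ τ)^[n + 1] (fun K => translateProd (fun x => 1 - c x) K 1) [] -
      (adsorb μ χ θ τ)^[n] (fun K => translateProd (fun x => 1 - c x) K 1) []‖ ≤
      τ * ((∫ u, ‖c u⁻¹‖ ∂μ) * (n * (τ * ((1 + τ * lam) ^ n * η)))) := by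
  set φ : G → ℂ := fun x => 1 - c x with hφ_def
  have hφ : Continuous φ := by fun_prop
  set H : List G → ℂ := fun K => translateProd φ K 1 with hH_def
  have hH : Continuous H := continuous_translateProd_left hφ 1
  have hci : Continuous fun u => c u⁻¹ := by fun_prop
  have hcis : HasCompactSupport fun u => c u⁻¹ := hcs.comp_homeomorph (Homeomorph.inv G)
  have hf1 : Continuous fun p : G × List G => testFun θ φ p.1 1 p.2 :=
    continuous_testFun hθ.continuous hφ continuous_id continuous_const
  have hf2 : Continuous fun p : G × List G => testFun θ φ 1 p.1⁻¹ p.2 :=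
    continuous_testFun hθ.continuous hφ continuous_const continuous_inv
  set D : List G → ℂ := fun K => ∫ u, c u⁻¹ * testFun θ φ u 1 K ∂μ with hD_def
  have hD : Continuous D := by
    rw [← continuousOn_univ]
    refine continuousOn_integral_of_compact_support (k := tsupport fun u => c u⁻¹) hcis ?_ ?_
    · refine Continuous.continuousOn ?_
      exact (hci.comp continuous_snd).mul (hf1.comp continuous_swap)
    · intro p u _ hu
      have : c u⁻¹ = 0 := image_eq_zero_of_notMem_tsupport (f := fun u => c u⁻¹) hu
      simp [this]
  -- Adding `u` changes the uncovered part by the factor `1 - c (u⁻¹)`, and the window equals 1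
  -- wherever `c (u⁻¹) ≠ 0`.
  have hstep : adsorb μ χ θ τ H = H - τ • D := by
    funext K
    simp only [adsorb, Pi.sub_apply, Pi.smul_apply, hD_def]
    rw [sub_eq_add_neg, ← smul_neg, ← integral_neg]
    congr 3
    funext u
    have : χ u * c u⁻¹ = c u⁻¹ := by
      by_cases h : c u⁻¹ = 0
      · simp [h]
      · simp [hχ1 u h]
    simp only [hH_def, translateProd_cons, testFun, hφ_def, mul_one, Complex.real_smul]
    push_cast
    linear_combination (-(avoid θ K u : ℂ) * translateProd (fun x => 1 - c x) K 1) * this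
  rw [Function.iterate_succ_apply, hstep,
    adsorb_iterate_sub_smul hχ.continuous hχ.hasCompactSupport hθ.continuous hH hD]
  simp only [Pi.sub_apply, Pi.smul_apply, sub_sub_cancel_left, norm_neg, norm_smul]
  rw [Real.norm_of_nonneg hτ]
  refine mul_le_mul_of_nonneg_left ?_ hτ
  have e1 : (adsorb μ χ θ τ)^[n] D [] =
      ∫ u, c u⁻¹ * (adsorb μ χ θ τ)^[n] (testFun θ φ u 1) [] ∂μ := by
    have := adsorb_iterate_integral (μ := μ) (τ := τ) hχ.continuous hχ.hasCompactSupport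
      hθ.continuous hci hcis (h := fun u => testFun θ φ u 1) hf1 n
    exact congrFun this []
  -- With the dropped point fixed at 1, the acceptance probability leaves the integral, and what
  -- remains is zero by `hint`.
  have e2 : ∫ u, c u⁻¹ * (adsorb μ χ θ τ)^[n] (testFun θ φ 1 u⁻¹) [] ∂μ = 0 := by
    have := adsorb_iterate_integral (μ := μ) (τ := τ) hχ.continuous hχ.hasCompactSupport
      hθ.continuous hci hcis (h := fun u => testFun θ φ 1 u⁻¹) hf2 n
    rw [← congrFun this []]
    have z : (fun K => ∫ u, c u⁻¹ * testFun θ φ 1 u⁻¹ K ∂μ) = fun _ => 0 := by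
      funext K
      have : ∀ u, c u⁻¹ * testFun θ φ 1 u⁻¹ K =
          avoid θ K 1 * (c u⁻¹ * translateProd φ K u⁻¹) := fun u => by
        rw [testFun]; ring
      simp only [this]
      rw [integral_const_mul, hint K, mul_zero]
    rw [z]
    have := norm_adsorb_iterate_le (h := fun _ => (0 : ℂ)) hχ hθ hτ continuous_const (C := 0)
      (fun K _ => by simp) n (K := []) List.Pairwise.nil
    exact norm_le_zero_iff.1 this
  have I1 : Integrable (fun u => c u⁻¹ * (adsorb μ χ θ τ)^[n] (testFun θ φ u 1) []) μ := by
    refine Continuous.integrable_of_hasCompactSupport (hci.mul ?_) hcis.mul_right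
    exact continuous_adsorb_iterate_left (h := fun u => testFun θ φ u 1) hχ.continuous
      hχ.hasCompactSupport hθ.continuous hf1 n []
  have I2 : Integrable (fun u => c u⁻¹ * (adsorb μ χ θ τ)^[n] (testFun θ φ 1 u⁻¹) []) μ := by
    refine Continuous.integrable_of_hasCompactSupport (hci.mul ?_) hcis.mul_right
    exact continuous_adsorb_iterate_left (h := fun u => testFun θ φ 1 u⁻¹) hχ.continuous
      hχ.hasCompactSupport hθ.continuous hf2 n []
  rw [e1, ← sub_zero (∫ u, _ ∂μ), ← e2, ← integral_sub I1 I2, ← integral_mul_const]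
  have I3 : Integrable (fun u => ‖c u⁻¹‖) μ := (hci.integrable_of_hasCompactSupport hcis).norm
  refine norm_integral_le_of_norm_le (I3.mul_const _) (ae_of_all _ fun u => ?_)
  rw [← mul_sub, norm_mul]
  by_cases hu : c u⁻¹ = 0
  · simp [hu]
  refine mul_le_mul_of_nonneg_left ?_ (norm_nonneg _)
  have hut : u⁻¹ ∈ tsupport c := subset_tsupport c hu
  -- The two expectations differ only through the replacement of `χ` by its translate, since the
  -- empty list is invariant.
  have ht := congrFun (adsorb_iterate_translate (μ := μ) (χ := χ) (θ := θ) (τ := τ) u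
    (testFun θ φ u 1) n) []
  rw [testFun_map] at ht
  simp only [List.map_nil] at ht
  rw [← ht, norm_sub_rev]
  exact norm_adsorb_iterate_sub_le hχ (hχ.comp_mul u) hθ hτ
    (continuous_testFun' hθ.continuous hφ 1 u⁻¹) hΛ hΛ0 hlam0 hlam (hinf _ hut) (hη u hut) n
    List.Pairwise.nil

/-- If `c` is a compactly supported function which is `1` near the identity, then some product of
`c` with functions `1 - c (v⁻¹ * ·)` has a nonzero right Haar integral. -/
theorem exists_integral_translateProd_ne_zero {c : G → ℂ} (hc : Continuous c)
    (hcs : HasCompactSupport c) (hc1 : ∀ᶠ x in 𝓝 (1 : G), c x = 1) :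
    ∃ K, ∫ r, c r⁻¹ * translateProd (fun x => 1 - c x) K r⁻¹ ∂μ ≠ 0 := by
  by_contra hcon
  push Not at hcon
  obtain ⟨κ, hκ, hκ1, hκc⟩ := exists_isCutoff hc1
  obtain ⟨O, hOo, hO1, hOO⟩ := exists_open_nhds_one_mul_subset hκ1
  have hOnhds : O ∈ 𝓝 (1 : G) := hOo.mem_nhds hO1
  obtain ⟨θ, hθ, hθ1, hθO⟩ := exists_isCutoff hOnhds
  obtain ⟨κ₀, hκ₀, hκ₀1, hκ₀O⟩ := exists_isCutoff hOnhds
  obtain ⟨S, hS⟩ := hcs.exists_bound_of_continuous hc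
  have hS0 : 0 ≤ S := (norm_nonneg _).trans (hS 1)
  obtain ⟨M, hM0, hM⟩ := exists_norm_translateProd_le (φ := fun x => 1 - c x) (C := 1 + S) hθ1
    (by linarith) (fun x => (norm_sub_le _ _).trans (by simpa using hS x)) hcs.isCompact
    (fun x hx => by simp [image_eq_zero_of_notMem_tsupport hx])
  obtain ⟨q, hq, hqinf⟩ := exists_influence_bound hθ hθ1 hc hcs
  obtain ⟨Λ, lam, hlam0, hΛ, hΛ0, hqΛ, hΛlam, hΛE⟩ := exists_weight (μ := μ) hθ.isBump hq
  set δ := ∫ u, κ₀ u⁻¹ ∂μ with hδ_def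
  have hδ : 0 < δ := by
    refine Continuous.integral_pos_of_hasCompactSupport_nonneg_nonzero (x := 1)
      (hκ₀.continuous.comp continuous_inv)
      (hκ₀.hasCompactSupport.comp_homeomorph (Homeomorph.inv G)) (fun u => hκ₀.nonneg _) ?_
    simp [hκ₀1.self_of_nhds]
  -- The time `T` makes the decay bound smaller than `1 / 4`. It and `lam` are fixed before the
  -- window, so the error constant `R` below does not depend on the window.
  obtain ⟨T, hT0, hT⟩ : ∃ T : ℝ, 0 < T ∧ M * Real.exp (-(T * δ)) < 1 / 4 := by
    have h1 : Tendsto (fun T : ℝ => M * Real.exp (-(T * δ))) atTop (𝓝 (M * 0)) :=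
      (Real.tendsto_exp_neg_atTop_nhds_zero.comp (tendsto_id.atTop_mul_const hδ)).const_mul M
    rw [mul_zero] at h1
    exact ((eventually_gt_atTop 0).and
      (h1.eventually (gt_mem_nhds (by norm_num : (0 : ℝ) < 1 / 4)))).exists
  set I := ∫ u, ‖c u⁻¹‖ ∂μ with hI_def
  have hI0 : 0 ≤ I := integral_nonneg fun _ => norm_nonneg _
  set R := (T + 1) * (I * ((T + 1) * Real.exp ((T + 1) * lam))) with hR_def
  have hR0 : 0 ≤ R := by positivity
  obtain ⟨η, hη0, hηR⟩ : ∃ η : ℝ, 0 < η ∧ R * η ≤ 1 / 4 := by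
    refine ⟨1 / (4 * (R + 1)), by positivity, ?_⟩
    rw [mul_one_div, div_le_div_iff₀ (by positivity) (by norm_num)]
    linarith
  obtain ⟨E, hE, hEΛ⟩ := hΛE η hη0
  have hW := hcs.isCompact
  -- The window is 1 on `E` and on its translates by the `g` with `g⁻¹ ∈ tsupport c`, so `χ` and `χ
  -- (g * ·)` differ only off `E`, where the weight has mass at most `η`. It is also 1 wherever `c
  -- (u⁻¹) ≠ 0`.
  obtain ⟨χ, hχ, hχ1, -⟩ := exists_isCutoff_of_isCompact
    ((hE.union (hW.inv.mul hE)).union hW.inv) isOpen_univ (Set.subset_univ _)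
  have hm0 : 0 ≤ ∫ x, χ x ∂μ := integral_nonneg hχ.nonneg
  set τ := 1 / (1 + ∫ x, χ x ∂μ) with hτ_def
  have hτ0 : 0 < τ := by positivity
  have hτ1 : τ ≤ 1 := by
    rw [hτ_def, div_le_one (by positivity)]; linarith
  have hχw : IsWindow μ τ χ := ⟨hχ.continuous, hχ.hasCompactSupport, hχ.nonneg, hχ.le_one, by
    rw [hτ_def, one_div, inv_mul_le_one₀ (by positivity)]; linarith⟩
  have hχc : ∀ u, c u⁻¹ ≠ 0 → χ u = 1 := fun u hu => hχ1 u (Or.inr (by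
    rw [Set.mem_inv]; exact subset_tsupport c hu))
  have hlam : ∀ w, ∫ u, χ u * θ (w⁻¹ * u) * Λ u ∂μ ≤ lam * Λ w := by
    intro w
    refine le_trans ?_ (hΛlam w)
    have hb := hθ.isBump.comp_inv_mul w
    refine integral_mono ?_ ?_ fun u => ?_
    · exact integrable_window hχ.continuous hχ.hasCompactSupport hb.continuous hΛ
    · exact (hb.continuous.mul hΛ).integrable_of_hasCompactSupport
        hb.hasCompactSupport.mul_right
    · exact mul_le_mul_of_nonneg_right (mul_le_of_le_one_left (hθ.nonneg _) (hχ.le_one u))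
        (hΛ0 u)
  have hη : ∀ g, g⁻¹ ∈ tsupport c → ∫ u, |χ u - χ (g * u)| * Λ u ∂μ ≤ η := by
    intro g hg
    have hχg := hχw.comp_mul g
    refine hEΛ _ ⟨(hχ.continuous.sub hχg.continuous).abs, ?_, fun u => abs_nonneg _⟩ ?_ ?_
    · exact (hχ.hasCompactSupport.sub hχg.hasCompactSupport).comp_left
        (g := fun x : ℝ => |x|) abs_zero
    · intro u
      rw [abs_le]
      constructor <;> linarith [hχ.nonneg u, hχ.le_one u, hχ.nonneg (g * u), hχ.le_one (g * u)]
    · intro u hu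
      rw [hχ1 u (Or.inl (Or.inl hu)),
        hχ1 (g * u) (Or.inl (Or.inr ⟨g, by simpa using hg, u, hu, rfl⟩))]
      simp
  have hinf : ∀ s ∈ tsupport c, InfluenceLE θ (testFun θ (fun x => 1 - c x) 1 s) Λ :=
    fun s hs L K w h => (hqinf s hs L K w h).trans (hqΛ w)
  set V : ℕ → ℂ := fun n =>
    (adsorb μ χ θ τ)^[n] (fun K => translateProd (fun x => 1 - c x) K 1) [] with hV_def
  set n := ⌈T / τ⌉₊ with hn_def
  have hn1 : T ≤ n * τ := by
    have := Nat.le_ceil (T / τ)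
    rwa [div_le_iff₀ hτ0] at this
  have hn2 : n * τ ≤ T + 1 := by
    have := (Nat.ceil_lt_add_one (div_nonneg hT0.le hτ0.le)).le
    calc n * τ ≤ (T / τ + 1) * τ := by gcongr
      _ = T + τ := by field_simp
      _ ≤ T + 1 := by linarith
  have hdecay : ‖V n‖ ≤ 1 / 4 := by
    have h := norm_adsorb_iterate_uncovered_le (μ := μ) hθ hκ hκ₀ hχw hτ0.le hM0.le hc
      (fun x hx => by
        by_contra h
        exact hx (hκc x h))
      hO1 (fun x hx y hy => hOO (Set.mul_mem_mul hx hy)) hθO hκ₀O hχc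
      (fun K hK => hM K 1 hK) n (K := []) List.Pairwise.nil
    rw [translateProd_nil, mul_one] at h
    refine h.trans (le_trans ?_ hT.le)
    refine mul_le_mul_of_nonneg_left ?_ hM0.le
    have hδτ : 0 ≤ 1 - τ * δ := by
      have hle : δ ≤ ∫ x, χ x ∂μ := by
        refine integral_mono (Continuous.integrable_of_hasCompactSupport
          (hκ₀.continuous.comp continuous_inv)
          (hκ₀.hasCompactSupport.comp_homeomorph (Homeomorph.inv G)))
          hχ.isBump.integrable fun u => ?_
        by_cases hu : u⁻¹ ∈ O
        · have hcu : c u⁻¹ = 1 := by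
            by_contra h
            have h1 := hOO (Set.mul_mem_mul hu hO1)
            rw [mul_one] at h1
            have h1 : κ u⁻¹ = 1 := h1
            rw [hκc _ h] at h1
            exact zero_ne_one h1
          rw [hχc u (by rw [hcu]; exact one_ne_zero)]
          exact hκ₀.le_one _
        · simpa only [hκ₀O _ hu] using hχ.nonneg u
      have := hχw.mass_le
      nlinarith
    calc (1 - τ * δ) ^ n ≤ (Real.exp (-(τ * δ))) ^ n := by
          refine pow_le_pow_left₀ hδτ ?_ n
          have := Real.add_one_le_exp (-(τ * δ))
          linarith
      _ = Real.exp (-(n * τ * δ)) := by rw [← Real.exp_nat_mul]; congr 1; ring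
      _ ≤ Real.exp (-(T * δ)) := by
          rw [Real.exp_le_exp]
          nlinarith
  -- The expectation starts at 1 on the empty list and drifts by a small multiple of `τ` per step;
  -- over `n * τ ≤ T + 1` the drift stays below `R * η`.
  have hconst : ∀ j ≤ n, ‖V j - 1‖ ≤ j * (τ * (I * ((T + 1) * Real.exp ((T + 1) * lam) * η))) := by
    intro j
    induction j with
    | zero => simp [hV_def]
    | succ j ih =>
      intro hj
      have h1 := ih (by omega)
      have h2 := norm_adsorb_iterate_succ_sub_le hθ hχw hτ0.le hc hcs hχc hcon hΛ hΛ0 hlam0 hlam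
        hinf hη j
      have hjn : (j : ℝ) * τ ≤ T + 1 := by
        refine le_trans (mul_le_mul_of_nonneg_right ?_ hτ0.le) hn2
        exact_mod_cast (by omega : j ≤ n)
      have h3 : (j : ℝ) * (τ * ((1 + τ * lam) ^ j * η)) ≤
          (T + 1) * Real.exp ((T + 1) * lam) * η := by
        have : (1 + τ * lam) ^ j ≤ Real.exp ((T + 1) * lam) := by
          calc (1 + τ * lam) ^ j ≤ (Real.exp (τ * lam)) ^ j := by
                refine pow_le_pow_left₀ (by positivity) ?_ j
                rw [add_comm]
                exact Real.add_one_le_exp _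
            _ = Real.exp (j * τ * lam) := by rw [← Real.exp_nat_mul]; congr 1; ring
            _ ≤ _ := by
              rw [Real.exp_le_exp]
              exact mul_le_mul_of_nonneg_right hjn hlam0
        calc (j : ℝ) * (τ * ((1 + τ * lam) ^ j * η)) = (j * τ) * (1 + τ * lam) ^ j * η := by ring
          _ ≤ _ := by gcongr
      have e : V (j + 1) - 1 = (V (j + 1) - V j) + (V j - 1) := by ring
      rw [e]
      refine (norm_add_le _ _).trans ?_
      have h4 : ‖V (j + 1) - V j‖ ≤
          τ * (I * ((T + 1) * Real.exp ((T + 1) * lam) * η)) :=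
        h2.trans (by gcongr)
      push_cast
      linarith
  have h1 := hconst n le_rfl
  have h2 : (n : ℝ) * (τ * (I * ((T + 1) * Real.exp ((T + 1) * lam) * η))) ≤ 1 / 4 := by
    refine le_trans ?_ hηR
    calc (n : ℝ) * (τ * (I * ((T + 1) * Real.exp ((T + 1) * lam) * η)))
        = (n * τ) * (I * ((T + 1) * Real.exp ((T + 1) * lam) * η)) := by ring
      _ ≤ (T + 1) * (I * ((T + 1) * Real.exp ((T + 1) * lam) * η)) := by gcongr
      _ = R * η := by rw [hR_def]; ring
  have h3 : (1 : ℝ) ≤ ‖V n‖ + ‖V n - 1‖ := by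
    have := norm_sub_le (V n) (V n - 1)
    rw [sub_sub_cancel] at this
    simpa using this
  linarith

end MassTransport

/-! ### Characters of commutative Banach algebras -/

section Characters

variable {A : Type*} [NonUnitalNormedCommRing A] [NormedSpace ℂ A]

lemma gelfand_mul (a b : A) (φ : characterSpace ℂ A) :
    gelfand (a * b) φ = gelfand a φ * gelfand b φ := map_mul φ a b

lemma gelfand_add (a b : A) (φ : characterSpace ℂ A) :
    gelfand (a + b) φ = gelfand a φ + gelfand b φ := map_add φ a b

lemma gelfand_sub (a b : A) (φ : characterSpace ℂ A) :
    gelfand (a - b) φ = gelfand a φ - gelfand b φ := map_sub φ a b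

lemma gelfand_smul (z : ℂ) (a : A) (φ : characterSpace ℂ A) :
    gelfand (z • a) φ = z * gelfand a φ := map_smul φ z a

lemma gelfand_zero (φ : characterSpace ℂ A) : gelfand (0 : A) φ = 0 := map_zero φ

lemma continuous_gelfand (a : A) : Continuous (gelfand a) :=
  (WeakDual.eval_continuous a).comp continuous_subtype_val

lemma exists_gelfand_ne_zero (φ : characterSpace ℂ A) : ∃ a : A, gelfand a φ ≠ 0 := by
  by_contra h
  push Not at h
  exact φ.2.1 (ContinuousLinearMap.ext h)

/-- A character, as an element of the normed dual. -/
noncomputable def charDual (φ : characterSpace ℂ A) : A →L[ℂ] ℂ := (φ : WeakDual ℂ A)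

/-- Characters of a Banach algebra are contractive. -/
lemma norm_gelfand_le [CompleteSpace A] (a : A) (φ : characterSpace ℂ A) :
    ‖gelfand a φ‖ ≤ ‖a‖ := by
  by_contra! h
  have h0 : gelfand a φ ≠ 0 := by
    intro h0
    rw [h0, norm_zero] at h
    exact (norm_nonneg a).not_gt h
  set c := (gelfand a φ)⁻¹ • a with hc
  have hφc : gelfand c φ = 1 := by rw [hc, gelfand_smul, inv_mul_cancel₀ h0]
  have hcn : ‖c‖ < 1 := by
    rw [hc, norm_smul, norm_inv, inv_mul_lt_one₀ (norm_pos_iff.2 h0)]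
    exact h
  -- The fixed point satisfies `x = c + c * x`, and applying `φ` with `φ c = 1` gives `φ x = 1 + φ
  -- x`.
  have hcontr : ContractingWith ‖c‖₊ fun x => c + c * x := by
    refine ⟨hcn, LipschitzWith.of_dist_le_mul fun x y => ?_⟩
    rw [dist_add_left, dist_eq_norm, dist_eq_norm, ← mul_sub]
    exact norm_mul_le _ _
  have hfix := hcontr.fixedPoint_isFixedPt
  have := congrArg (fun x => gelfand x φ) hfix
  simp only [gelfand_add, gelfand_mul, hφc, one_mul] at this
  exact one_ne_zero (add_eq_right.1 this)

lemma IsSemisimple.mul_eq_zero (hA : IsSemisimple A) {a b : A}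
    (h : ∀ φ, gelfand a φ ≠ 0 → gelfand b φ = 0) : a * b = 0 :=
  hA _ fun φ => by
    rw [gelfand_mul]
    by_cases ha : gelfand a φ = 0
    · rw [ha, zero_mul]
    · rw [h φ ha, mul_zero]

/-- Condition (M) for the zero element, with any `ε`, already supplies units supported in a given
neighbourhood. -/
lemma ConditionM.exists_local_unit (hM : ConditionM A) (φ : characterSpace ℂ A)
    {U : Set (characterSpace ℂ A)} (hU : U ∈ 𝓝 φ) :
    ∃ b : A, (∀ᶠ ψ in 𝓝 φ, gelfand b ψ = 1) ∧ tsupport (gelfand b) ⊆ U := by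
  obtain ⟨b, ⟨V, hV, hb⟩, hbU, -⟩ := hM.inf_eq_zero φ 0 (gelfand_zero φ) U hU 1 one_pos
  exact ⟨b, mem_of_superset hV hb, hbU⟩

end Characters

/-! ### Supports of the functionals induced by a separating map -/

section Support

variable {A B : Type*} [NonUnitalNormedCommRing A] [NormedSpace ℂ A]
  [NonUnitalNormedCommRing B] [NormedSpace ℂ B] {T : A →ₗ[ℂ] B} {y : characterSpace ℂ B}

/-- If `a` vanishes near a point of the support of the functional, then the functional vanishes
at `a`. -/
lemma gelfand_map_eq_zero_of_isOpen (hA : IsSemisimple A) (hT : IsSeparating T)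
    {p : OnePoint (characterSpace ℂ A)} (hp : p ∈ functionalSupport T y)
    {W : Set (OnePoint (characterSpace ℂ A))} (hW : IsOpen W) (hpW : p ∈ W) {a : A}
    (ha : ∀ φ : characterSpace ℂ A, (φ : OnePoint _) ∈ W → gelfand a φ = 0) :
    gelfand (T a) y = 0 := by
  have hn : ¬ IsVanishingSet T y W := fun h => hp ⟨W, h, hpW⟩
  simp only [IsVanishingSet, not_and, not_forall] at hn
  -- As `W` is not a vanishing set, some `b` living on `W` is not killed; `b * a = 0` then forces
  -- the functional to kill `a`.
  obtain ⟨b, hb, hb0⟩ := hn hW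
  have hba : b * a = 0 := hA.mul_eq_zero fun φ hφ => ha φ (hb φ hφ)
  have := congrArg (fun x => gelfand x y) (hT b a hba)
  rw [gelfand_mul, gelfand_zero] at this
  exact (mul_eq_zero.1 this).resolve_left hb0

lemma gelfand_map_eq_zero_of_eventually (hA : IsSemisimple A) (hT : IsSeparating T)
    {x : characterSpace ℂ A} (hx : (x : OnePoint _) ∈ functionalSupport T y) {a : A}
    (ha : ∀ᶠ φ in 𝓝 x, gelfand a φ = 0) : gelfand (T a) y = 0 := by
  obtain ⟨V, hV, hVo, hxV⟩ := eventually_nhds_iff.1 ha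
  refine gelfand_map_eq_zero_of_isOpen hA hT hx (OnePoint.isOpen_image_coe.2 hVo) ⟨x, hxV, rfl⟩ ?_
  rintro φ ⟨ψ, hψ, h⟩
  rw [← OnePoint.coe_injective h]
  exact hV ψ hψ

lemma gelfand_map_eq_of_eventuallyEq (hA : IsSemisimple A) (hT : IsSeparating T)
    {x : characterSpace ℂ A} (hx : (x : OnePoint _) ∈ functionalSupport T y) {a b : A}
    (h : ∀ᶠ φ in 𝓝 x, gelfand a φ = gelfand b φ) : gelfand (T a) y = gelfand (T b) y := by
  rw [← sub_eq_zero, ← gelfand_sub, ← map_sub]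
  refine gelfand_map_eq_zero_of_eventually hA hT hx (h.mono fun φ hφ => ?_)
  rw [gelfand_sub, hφ, sub_self]

variable [LocallyCompactSpace (characterSpace ℂ A)]

lemma functionalSupport_subsingleton (hA : IsSemisimple A) (hT : IsSeparating T) :
    (functionalSupport T y).Subsingleton := by
  intro p hp q hq
  by_contra hpq
  obtain ⟨U, V, hU, hV, hpU, hqV, hUV⟩ := t2_separation hpq
  have hn : ¬ IsVanishingSet T y V := fun h => hq ⟨V, h, hqV⟩
  simp only [IsVanishingSet, not_and, not_forall] at hn
  obtain ⟨b, hb, hb0⟩ := hn hV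
  refine hb0 (gelfand_map_eq_zero_of_isOpen hA hT hp hU hpU fun φ hφ => ?_)
  by_contra h
  exact Set.disjoint_left.1 hUV hφ (hb φ h)

/-- Otherwise vanishing sets cover the compactification. The one containing `∞` has compact
complement, and subtracting finitely many `b * a`, each living on a vanishing set, makes `a` zero on
that complement without changing the value of the functional. -/
lemma functionalSupport_nonempty (hM : ConditionM A) (hy : y ∈ supportMapDomain T) :
    (functionalSupport T y).Nonempty := by
  by_contra hne
  have hcov : ∀ p, ∃ V, IsVanishingSet T y V ∧ p ∈ V := by
    intro p
    by_contra h
    refine hne ⟨p, ?_⟩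
    rintro ⟨V, hV, hpV⟩
    exact h ⟨V, hV, hpV⟩
  obtain ⟨V, ⟨hVo, hV⟩, hVi⟩ := hcov OnePoint.infty
  have hK : IsCompact ((↑) ⁻¹' V : Set (characterSpace ℂ A))ᶜ :=
    ((OnePoint.isOpen_iff_of_mem hVi).1 hVo).2
  obtain ⟨a, ha⟩ := hy
  -- The induction statement also keeps the zeros of `a`, so that corrections for one piece do not
  -- spoil an earlier one.
  have key := hK.induction_on
    (p := fun s => ∀ a : A, ∃ a' : A, gelfand (T a') y = gelfand (T a) y ∧
      (∀ φ, gelfand a φ = 0 → gelfand a' φ = 0) ∧ ∀ φ ∈ s, gelfand a' φ = 0)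
    (fun a => ⟨a, rfl, fun _ h => h, fun _ h => h.elim⟩)
    (fun s t hst ht a => by
      obtain ⟨a', h1, h2, h3⟩ := ht a
      exact ⟨a', h1, h2, fun φ hφ => h3 φ (hst hφ)⟩)
    (fun s t hs ht a => by
      obtain ⟨a', h1, h2, h3⟩ := hs a
      obtain ⟨a'', k1, k2, k3⟩ := ht a'
      refine ⟨a'', k1.trans h1, fun φ h => k2 φ (h2 φ h), ?_⟩
      rintro φ (hφ | hφ)
      · exact k2 φ (h3 φ hφ)
      · exact k3 φ hφ)
    (fun x _ => by
      obtain ⟨W, ⟨hWo, hW⟩, hxW⟩ := hcov x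
      obtain ⟨b, hb1, hbW⟩ := hM.exists_local_unit x
        ((hWo.preimage OnePoint.continuous_coe).mem_nhds hxW)
      refine ⟨_, mem_nhdsWithin_of_mem_nhds hb1, fun a => ⟨a - b * a, ?_, ?_, ?_⟩⟩
      · rw [map_sub, gelfand_sub, hW (b * a), sub_zero]
        intro φ hφ
        refine hbW (subset_tsupport _ ?_)
        rw [gelfand_mul] at hφ
        exact left_ne_zero_of_mul hφ
      · intro φ hφ
        rw [gelfand_sub, gelfand_mul, hφ, mul_zero, sub_zero]
      · intro φ hφ
        have hφ : gelfand b φ = 1 := hφ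
        rw [gelfand_sub, gelfand_mul, hφ, one_mul, sub_self])
  obtain ⟨a', h1, -, h3⟩ := key a
  refine ha (h1 ▸ hV a' fun φ hφ => ?_)
  by_contra h
  exact hφ (h3 φ h)

/-- The functional vanishes at the elements with compact support, if the point of its support does
not belong to this support. -/
lemma gelfand_map_eq_zero_of_hasCompactSupport (hA : IsSemisimple A) (hT : IsSeparating T)
    {p : OnePoint (characterSpace ℂ A)} (hp : p ∈ functionalSupport T y) {a : A}
    (ha : HasCompactSupport (gelfand a)) (hpa : p ∉ (↑) '' tsupport (gelfand a)) :
    gelfand (T a) y = 0 := by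
  have hc : IsClosed ((↑) '' tsupport (gelfand a) : Set (OnePoint (characterSpace ℂ A))) :=
    (ha.isCompact.image OnePoint.continuous_coe).isClosed
  refine gelfand_map_eq_zero_of_isOpen hA hT hp hc.isOpen_compl hpa fun φ hφ => ?_
  exact image_eq_zero_of_notMem_tsupport fun h => hφ ⟨φ, h, rfl⟩

/-- The points that are supports of functionals are dense. -/
lemma exists_mem_functionalSupport (hA : IsSemisimple A) (hB : IsSemisimple B) (hM : ConditionM A)
    (hTi : Function.Injective T) (hT : IsSeparating T) {U : Set (characterSpace ℂ A)}
    (hU : IsOpen U) (hne : U.Nonempty) :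
    ∃ x ∈ U, ∃ y : characterSpace ℂ B, (x : OnePoint _) ∈ functionalSupport T y := by
  obtain ⟨x, hx⟩ := hne
  obtain ⟨k, hk, hkU, hkc⟩ := local_compact_nhds (hU.mem_nhds hx)
  obtain ⟨b, hb1, hbk⟩ := hM.exists_local_unit x hk
  have hbs : HasCompactSupport (gelfand b) :=
    hkc.of_isClosed_subset (isClosed_tsupport _) hbk
  have hTb : T b ≠ 0 := by
    rw [Ne, map_eq_zero_iff T hTi]
    rintro rfl
    have := hb1.self_of_nhds
    rw [gelfand_zero] at this
    exact zero_ne_one this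
  obtain ⟨y, hy⟩ : ∃ y, gelfand (T b) y ≠ 0 := by
    by_contra! h
    exact hTb (hB _ h)
  obtain ⟨p, hp⟩ := functionalSupport_nonempty hM ⟨b, hy⟩
  by_contra! hcon
  refine hy (gelfand_map_eq_zero_of_hasCompactSupport hA hT hp hbs ?_)
  rintro ⟨z, hz, rfl⟩
  exact hcon z (hkU (hbk hz)) y hp

end Support

/-! ### Gliding hump and singular points -/

section GlidingHump

/-- Infinitely many points of a set in a regular Hausdorff space have disjoint neighbourhoods. -/
lemma exists_seq_disjoint_nhds {X : Type*} [TopologicalSpace X] [T3Space X] {P : Set X}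
    (hP : P.Infinite) : ∃ (x : ℕ → X) (V : ℕ → Set X), (∀ n, x n ∈ P) ∧ (∀ n, V n ∈ 𝓝 (x n)) ∧
      Pairwise fun m n => Disjoint (V m) (V n) := by
  have := hP.to_subtype
  obtain ⟨U, hUi, hUo, hUd⟩ := exists_seq_infinite_isOpen_pairwise_disjoint P
  choose x hx using fun n => (hUi n).nonempty
  choose O hO hOU using fun n => isOpen_induced_iff.1 (hUo n)
  have hxO : ∀ n, (x n : X) ∈ O n := fun n => by
    have := hx n
    rw [← hOU n] at this
    exact this
  choose F hF hFc hFO using fun n => exists_mem_nhds_isClosed_subset ((hO n).mem_nhds (hxO n))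
  have hxF : ∀ m n, m ≠ n → (x n : X) ∉ F m := fun m n hmn h => by
    have h1 : x n ∈ U m := by rw [← hOU m]; exact hFO m h
    exact Set.disjoint_left.1 (hUd hmn) h1 (hx n)
  -- The sets `F n` are disjoint only on `P`; removing the earlier closed sets makes them disjoint
  -- in `X`, and no `x n` is lost.
  refine ⟨fun n => x n, fun n => F n ∩ ⋂ i ∈ Finset.range n, (F i)ᶜ, fun n => (x n).2,
    fun n => ?_, ?_⟩
  · refine inter_mem (hF n) ((biInter_finset_mem _).2 fun i hi => ?_)
    exact (hFc i).isOpen_compl.mem_nhds (hxF i n (Finset.mem_range.1 hi).ne)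
  · have key : ∀ m n, m < n → Disjoint (F m ∩ ⋂ i ∈ Finset.range m, (F i)ᶜ)
        (F n ∩ ⋂ i ∈ Finset.range n, (F i)ᶜ) := fun m n hmn => by
      rw [Set.disjoint_left]
      rintro z ⟨hz, -⟩ ⟨-, hz'⟩
      exact Set.mem_iInter₂.1 hz' m (Finset.mem_range.2 hmn) hz
    intro m n hmn
    rcases hmn.lt_or_gt with h | h
    · exact key m n h
    · exact (key n m h).symm

variable {A B : Type*} [NonUnitalNormedCommRing A] [NormedSpace ℂ A]
  [NonUnitalNormedCommRing B] [NormedSpace ℂ B] {T : A →ₗ[ℂ] B}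

/-- The points at which the functional of some character of `B` has its support, without being a
multiple of the evaluation at this point. -/
def singularPoints (T : A →ₗ[ℂ] B) : Set (characterSpace ℂ A) :=
  {x | ∃ y, (x : OnePoint _) ∈ functionalSupport T y ∧
    ∃ a : A, gelfand a x = 0 ∧ gelfand (T a) y ≠ 0}

/-- With infinitely many singular points, scale elements vanishing at them so that the functionals
take the value `n`, and shrink them by (M) into a convergent sum of disjoint humps. By locality the
image of the sum takes the value `n` at `y n`, although it is bounded by its norm. -/
lemma finite_singularPoints [CompleteSpace A] [CompleteSpace B]
    [LocallyCompactSpace (characterSpace ℂ A)] (hA : IsSemisimple A) (hM : ConditionM A)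
    (hT : IsSeparating T) : (singularPoints T).Finite := by
  by_contra hinf
  obtain ⟨x, V, hxP, hV, hVd⟩ := exists_seq_disjoint_nhds hinf
  choose y hy a₀ ha₀ hya₀ using hxP
  have : ∀ n : ℕ, ∃ a : A, gelfand a (x n) = 0 ∧ gelfand (T a) (y n) = n := fun n =>
    ⟨((n : ℂ) / gelfand (T (a₀ n)) (y n)) • a₀ n, by rw [gelfand_smul, ha₀, mul_zero], by
      rw [map_smul, gelfand_smul, div_mul_cancel₀ _ (hya₀ n)]⟩
  choose a ha hya using this
  choose b hb hbV hba using fun n => hM.inf_eq_zero (x n) (a n) (ha n) (V n) (hV n)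
    ((1 / 2 : ℝ) ^ n) (by positivity)
  have hsum : Summable fun n => b n * a n :=
    Summable.of_norm_bounded summable_geometric_two fun n => (hba n).le
  set s := ∑' n, b n * a n
  have hs : ∀ n, ∀ φ ∈ V n, gelfand s φ = gelfand (b n * a n) φ := by
    intro n φ hφ
    have h1 : HasSum (fun m => gelfand (b m * a m) φ) (gelfand s φ) :=
      hsum.hasSum.mapL (φ : WeakDual ℂ A)
    refine h1.unique (hasSum_single n fun m hm => ?_)
    rw [gelfand_mul, image_eq_zero_of_notMem_tsupport (f := gelfand (b m)), zero_mul]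
    exact fun h => Set.disjoint_left.1 (hVd hm) (hbV m h) hφ
  have hTs : ∀ n : ℕ, gelfand (T s) (y n) = n := by
    intro n
    rw [← hya n]
    refine gelfand_map_eq_of_eventuallyEq hA hT (hy n) ?_
    obtain ⟨W, hW, hbW⟩ := hb n
    filter_upwards [hV n, hW] with φ h1 h2
    rw [hs n φ h1, gelfand_mul, hbW φ h2, one_mul]
  obtain ⟨n, hn⟩ := exists_nat_gt ‖T s‖
  have := norm_gelfand_le (T s) (y n)
  rw [hTs n, Complex.norm_natCast] at this
  linarith

end GlidingHump

/-! ### Bijective separating maps as weighted composition operators -/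

section Representation

variable {A B : Type*} [NonUnitalNormedCommRing A] [NormedSpace ℂ A]
  [NonUnitalNormedCommRing B] [NormedSpace ℂ B] {T : A →ₗ[ℂ] B}

/-- The support of the functional of `y` is `x`, and the functional vanishes whenever `a` vanishes
at `x`. -/
def IsRegularAt (T : A →ₗ[ℂ] B) (y : characterSpace ℂ B) (x : characterSpace ℂ A) : Prop :=
  (x : OnePoint _) ∈ functionalSupport T y ∧ ∀ a : A, gelfand a x = 0 → gelfand (T a) y = 0

lemma IsRegularAt.exists_eq_mul {y : characterSpace ℂ B} {x : characterSpace ℂ A}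
    (h : IsRegularAt T y x) (hy : y ∈ supportMapDomain T) :
    ∃ w : ℂ, w ≠ 0 ∧ ∀ a, gelfand (T a) y = w * gelfand a x := by
  obtain ⟨b, hb⟩ := exists_gelfand_ne_zero x
  have key : ∀ a, gelfand (T a) y = gelfand (T b) y / gelfand b x * gelfand a x := by
    intro a
    have := h.2 (a - (gelfand a x / gelfand b x) • b) (by
      rw [gelfand_sub, gelfand_smul, div_mul_cancel₀ _ hb, sub_self])
    rw [map_sub, map_smul, gelfand_sub, gelfand_smul, sub_eq_zero] at this
    rw [this]
    ring
  refine ⟨_, fun h0 => ?_, key⟩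
  obtain ⟨a, ha⟩ := hy
  rw [key, h0, zero_mul] at ha
  exact ha rfl

variable [CompleteSpace A] [CompleteSpace B] [LocallyCompactSpace (characterSpace ℂ A)]

/-- The characters with a regular functional form a closed set. -/
lemma isClosed_setOf_isRegularAt (hA : IsSemisimple A) (hM : ConditionM A)
    (hd : HasDenseCompactlySupported A) (hT : IsSeparating T)
    (hdom : ∀ y, y ∈ supportMapDomain T) : IsClosed {y | ∃ x, IsRegularAt T y x} := by
  refine isClosed_of_closure_subset fun y₀ hy₀ => ?_
  choose x hx using fun y : {y | ∃ x, IsRegularAt T y x} => y.2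
  choose w _ hwx using fun y => (hx y).exists_eq_mul (hdom y)
  -- `T` is not assumed continuous, but regular functionals are multiples of evaluations, hence
  -- continuous, and are bounded by `‖T a‖` at each `a`. The uniform bound passes to the closure.
  obtain ⟨C, hC⟩ := banach_steinhaus (g := fun y => w y • charDual (x y))
    fun a => ⟨‖T a‖, fun y => by
      have : (w y • charDual (x y)) a = gelfand (T a) y := (hwx y a).symm
      rw [this]
      exact norm_gelfand_le _ _⟩
  have hbound : ∀ a, ‖gelfand (T a) y₀‖ ≤ C * ‖a‖ := by
    intro a
    refine closure_minimal (t := {y | ‖gelfand (T a) y‖ ≤ C * ‖a‖}) (fun y hy => ?_)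
      (isClosed_le (continuous_gelfand _).norm continuous_const) hy₀
    have : gelfand (T a) y = (w ⟨y, hy⟩ • charDual (x ⟨y, hy⟩)) a :=
      hwx ⟨y, hy⟩ a
    rw [Set.mem_ofPred_eq, this]
    exact ContinuousLinearMap.le_of_opNorm_le _ (hC _) a
  obtain ⟨p, hp⟩ := functionalSupport_nonempty hM (hdom y₀)
  induction p using OnePoint.rec with
  | infty =>
    exfalso
    obtain ⟨a, ha⟩ := hdom y₀
    let L : A →L[ℂ] ℂ := LinearMap.mkContinuous
      ((charDual y₀).toLinearMap.comp T) C hbound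
    refine ha ?_
    -- A continuous functional supported at `∞` kills all elements with compact support, which are
    -- dense.
    have : L = 0 := by
      refine ContinuousLinearMap.ext fun a => ?_
      refine congrFun (Continuous.ext_on hd L.continuous continuous_const fun a ha => ?_) a
      exact gelfand_map_eq_zero_of_hasCompactSupport hA hT hp ha (by simp)
    exact congrArg (fun f : A →L[ℂ] ℂ => f a) this
  | coe x =>
    refine ⟨x, hp, fun a ha => ?_⟩
    refine norm_le_zero_iff.1 (le_of_forall_pos_le_add fun ε hε => ?_)
    have hC0 : 0 < |C| + 1 := by positivity
    -- By locality `a` may be replaced by `b * a`, whose norm is arbitrarily small by (M).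
    obtain ⟨b, ⟨V, hV, hbV⟩, -, hba⟩ := hM.inf_eq_zero x a ha Set.univ univ_mem (ε / (|C| + 1))
      (by positivity)
    have : gelfand (T a) y₀ = gelfand (T (b * a)) y₀ := by
      refine gelfand_map_eq_of_eventuallyEq hA hT hp ?_
      filter_upwards [hV] with φ hφ
      rw [gelfand_mul, hbV φ hφ, one_mul]
    rw [this, zero_add]
    refine (hbound _).trans ?_
    calc C * ‖b * a‖ ≤ (|C| + 1) * (ε / (|C| + 1)) := by
          gcongr
          linarith [le_abs_self C]
      _ = ε := mul_div_cancel₀ _ hC0.ne'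

/-- A bijective separating map is a weighted composition operator. -/
theorem exists_isRegularAt (hA : IsRegularTauberian A) (hM : ConditionM A)
    (hB : IsRegularTauberian B) (hTb : Function.Bijective T) (hT : IsSeparating T)
    (y : characterSpace ℂ B) : ∃ x, IsRegularAt T y x := by
  have hdom : ∀ y, y ∈ supportMapDomain T := fun y => by
    obtain ⟨b, hb⟩ := exists_gelfand_ne_zero y
    obtain ⟨a, rfl⟩ := hTb.2 b
    exact ⟨a, hb⟩
  by_contra hy
  obtain ⟨g, hg1, hg0⟩ := hB.regular y {y | ∃ x, IsRegularAt T y x}ᶜ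
    (isClosed_setOf_isRegularAt hA.semisimple hM hA.dense_compactlySupported hT
      hdom).isOpen_compl hy
  obtain ⟨a, rfl⟩ := hTb.2 g
  have hreg : ∀ y x, IsRegularAt T y x → gelfand a x = 0 := by
    intro y x h
    obtain ⟨w, hw, hwa⟩ := h.exists_eq_mul (hdom y)
    have := hg0 y (fun h' => h' ⟨x, h⟩)
    rw [hwa] at this
    exact (mul_eq_zero.1 this).resolve_left hw
  have hopen : IsOpen {x | gelfand a x ≠ 0} := isOpen_ne_fun (continuous_gelfand a) continuous_const
  have hfin := finite_singularPoints hA.semisimple hM hT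
  -- Off the finite singular set, support points are dense and belong to regular functionals, where
  -- `a` vanishes.
  have hsub : ∀ x, gelfand a x ≠ 0 → x ∈ singularPoints T := by
    intro x hx
    by_contra hxs
    obtain ⟨x', ⟨hx', hx's⟩, y', hy'⟩ := exists_mem_functionalSupport hA.semisimple hB.semisimple hM
      hTb.1 hT (hopen.inter hfin.isClosed.isOpen_compl) ⟨x, hx, hxs⟩
    refine hx' (hreg y' x' ⟨hy', fun b hb => ?_⟩)
    by_contra h
    exact hx's ⟨y', hy', b, hb, h⟩
  obtain ⟨x, hx⟩ : ∃ x, gelfand a x ≠ 0 := by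
    by_contra! h
    rw [hA.semisimple a h, map_zero, gelfand_zero] at hg1
    exact zero_ne_one hg1
  have hxo : IsOpen {x} := by
    have : {x} = {x | gelfand a x ≠ 0} ∩ (singularPoints T \ {x})ᶜ := by
      ext z
      constructor
      · rintro rfl
        exact ⟨hx, fun h => h.2 rfl⟩
      · rintro ⟨h1, h2⟩
        by_contra h
        exact h2 ⟨hsub z h1, h⟩
    rw [this]
    exact hopen.inter (hfin.subset Set.sdiff_subset).isClosed.isOpen_compl
  obtain ⟨_, rfl, y', hy'⟩ := exists_mem_functionalSupport hA.semisimple hB.semisimple hM hTb.1 hT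
    hxo (Set.singleton_nonempty x)
  -- At an isolated point, vanishing at the point is vanishing nearby, so the functional is regular
  -- there.
  refine hx (hreg y' _ ⟨hy', fun b hb => ?_⟩)
  refine gelfand_map_eq_zero_of_eventually hA.semisimple hT hy' ?_
  filter_upwards [hxo.mem_nhds rfl] with φ hφ
  rw [hφ, hb]

lemma exists_supportMap (hA : IsRegularTauberian A) (hM : ConditionM A)
    (hB : IsRegularTauberian B) (hTb : Function.Bijective T) (hT : IsSeparating T) :
    ∃ t : characterSpace ℂ B → characterSpace ℂ A, ∀ y, y ∈ supportMapDomain T ∧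
      functionalSupport T y = {((t y : characterSpace ℂ A) : OnePoint _)} ∧
      ∃ w : ℂ, w ≠ 0 ∧ ∀ a, gelfand (T a) y = w * gelfand a (t y) := by
  choose t ht using exists_isRegularAt hA hM hB hTb hT
  refine ⟨t, fun y => ?_⟩
  have hdom : y ∈ supportMapDomain T := by
    obtain ⟨b, hb⟩ := exists_gelfand_ne_zero y
    obtain ⟨a, rfl⟩ := hTb.2 b
    exact ⟨a, hb⟩
  exact ⟨hdom, Set.eq_singleton_iff_unique_mem.2 ⟨(ht y).1, fun q hq =>
    functionalSupport_subsingleton hA.semisimple hT hq (ht y).1⟩, (ht y).exists_eq_mul hdom⟩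

/-- Weights are nonzero, so the cozero set of `T a` is the preimage under `t` of that of `a`; by
regularity cozero sets form a base. -/
lemma continuous_of_gelfand_eq_mul (hA : IsRegular A) {t : characterSpace ℂ B → characterSpace ℂ A}
    (ht : ∀ y, ∃ w : ℂ, w ≠ 0 ∧ ∀ a, gelfand (T a) y = w * gelfand a (t y)) : Continuous t := by
  refine continuous_def.2 fun U hU => isOpen_iff_mem_nhds.2 fun y hy => ?_
  obtain ⟨a, ha1, ha0⟩ := hA (t y) U hU hy
  have : {y | gelfand (T a) y ≠ 0} ∈ 𝓝 y := by
    refine (isOpen_ne_fun (continuous_gelfand _) continuous_const).mem_nhds ?_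
    obtain ⟨w, hw, h⟩ := ht y
    rw [Set.mem_ofPred_eq, h, ha1, mul_one]
    exact hw
  filter_upwards [this] with z hz
  by_contra hzU
  obtain ⟨w, hw, h⟩ := ht z
  exact hz (by rw [h, ha0 _ hzU, mul_zero])

/-- The support map of a bijective separating map is a homeomorphism. -/
theorem exists_supportMap_homeomorph [LocallyCompactSpace (characterSpace ℂ B)]
    (hA : IsRegularTauberian A) (hMA : ConditionM A) (hB : IsRegularTauberian B)
    (hMB : ConditionM B) (hTb : Function.Bijective T) (hT : IsSeparating T) :
    ∃ t : characterSpace ℂ B ≃ₜ characterSpace ℂ A, ∀ y, y ∈ supportMapDomain T ∧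
      functionalSupport T y = {((t y : characterSpace ℂ A) : OnePoint _)} ∧
      ∃ w : ℂ, w ≠ 0 ∧ ∀ a, gelfand (T a) y = w * gelfand a (t y) := by
  obtain ⟨t, ht⟩ := exists_supportMap hA hMA hB hTb hT
  set S : B →ₗ[ℂ] A := (LinearEquiv.ofBijective T hTb).symm.toLinearMap with hS
  have hTS : ∀ b, T (S b) = b := fun b => (LinearEquiv.ofBijective T hTb).apply_symm_apply b
  have hST : ∀ a, S (T a) = a := fun a => (LinearEquiv.ofBijective T hTb).symm_apply_apply a
  -- A product of preimages vanishes at every `t y`, and these points are dense.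
  have hSsep : IsSeparating S := by
    intro f g hfg
    refine hA.semisimple _ fun x => ?_
    by_contra hx
    obtain ⟨x', hx', y, hy⟩ := exists_mem_functionalSupport hA.semisimple hB.semisimple hMA hTb.1
      hT (isOpen_ne_fun (continuous_gelfand (S f * S g)) continuous_const) ⟨x, hx⟩
    rw [(ht y).2.1] at hy
    obtain rfl := OnePoint.coe_injective hy
    obtain ⟨w, hw, hwa⟩ := (ht y).2.2
    have h := congrArg (fun b => gelfand b y) hfg
    simp only [gelfand_mul, gelfand_zero] at h
    rw [← hTS f, ← hTS g, hwa, hwa] at h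
    refine hx' ?_
    rw [gelfand_mul]
    have : w * w * (gelfand (S f) (t y) * gelfand (S g) (t y)) = 0 := by rw [← h]; ring
    exact (mul_eq_zero.1 this).resolve_left (mul_ne_zero hw hw)
  obtain ⟨s, hs⟩ := exists_supportMap hB hMB hA
    (LinearEquiv.ofBijective T hTb).symm.bijective hSsep
  -- If `s (t y) ≠ y`, a function that is 1 at `y` and 0 at `s (t y)` contradicts the two weighted
  -- composition formulas, applied in turn.
  have hst : ∀ y, s (t y) = y := by
    intro y
    by_contra h
    obtain ⟨b, hb1, hb0⟩ := hB.regular y {s (t y)}ᶜ isOpen_compl_singleton (Ne.symm h)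
    obtain ⟨w, hw, hwa⟩ := (ht y).2.2
    obtain ⟨v, hv, hva⟩ := (hs (t y)).2.2
    have h1 := hwa (S b)
    rw [hTS, hb1, hva b, hb0 _ (fun h => h rfl), mul_zero, mul_zero] at h1
    exact one_ne_zero h1
  have hts : ∀ x, t (s x) = x := by
    intro x
    by_contra h
    obtain ⟨a, ha1, ha0⟩ := hA.regular x {t (s x)}ᶜ isOpen_compl_singleton (Ne.symm h)
    obtain ⟨w, hw, hwa⟩ := (ht (s x)).2.2
    obtain ⟨v, hv, hva⟩ := (hs x).2.2
    have h1 := hva (T a)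
    rw [hST, ha1, hwa a, ha0 _ (fun h => h rfl), mul_zero, mul_zero] at h1
    exact one_ne_zero h1
  exact ⟨{ toFun := t
           invFun := s
           left_inv := hst
           right_inv := hts
           continuous_toFun := continuous_of_gelfand_eq_mul hA.regular fun y => (ht y).2.2
           continuous_invFun := continuous_of_gelfand_eq_mul hB.regular fun x => (hs x).2.2 }, ht⟩

end Representation

/-! ### Local convolution products that do not vanish -/

section Multiplicativity

variable {G A : Type*} [Group G] [TopologicalSpace G] [MeasurableSpace G]
  [NonUnitalNormedCommRing A] [NormedSpace ℂ A] {μ : Measure G} {e : G ≃ₜ characterSpace ℂ A}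

lemma continuous_toFun (e : G ≃ₜ characterSpace ℂ A) (a : A) : Continuous (toFun e a) :=
  (continuous_gelfand a).comp e.continuous

lemma toFun_mul (a b : A) (x : G) : toFun e (a * b) x = toFun e a x * toFun e b x :=
  gelfand_mul a b _

lemma toFun_sub (a b : A) (x : G) : toFun e (a - b) x = toFun e a x - toFun e b x :=
  gelfand_sub a b _

lemma exists_toFun_local_unit (hM : ConditionM A) (e : G ≃ₜ characterSpace ℂ A) {x : G} {U : Set G}
    (hU : U ∈ 𝓝 x) :
    ∃ b : A, (∀ᶠ s in 𝓝 x, toFun e b s = 1) ∧ tsupport (toFun e b) ⊆ U := by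
  have hU' : e.symm ⁻¹' U ∈ 𝓝 (e x) := by
    refine e.symm.continuous.continuousAt.preimage_mem_nhds ?_
    rwa [e.symm_apply_apply]
  obtain ⟨b, hb, hbU⟩ := hM.exists_local_unit (e x) hU'
  refine ⟨b, e.continuous.continuousAt.eventually hb, ?_⟩
  refine (tsupport_comp_subset_preimage (gelfand b) e.continuous).trans fun s hs => ?_
  simpa using hbU hs

/-- The products of `f` with functions `1 - f (v⁻¹ * ·)` belong to the algebra. -/
lemma IsConvolutionFunctionAlgebra.exists_mul_translateProd
    (hA : IsConvolutionFunctionAlgebra μ e) (f : A) (K : List G) :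
    ∃ h : A, ∀ x, toFun e h x =
      toFun e f x * translateProd (fun s => 1 - toFun e f s) K x := by
  induction K with
  | nil => exact ⟨f, fun x => by simp⟩
  | cons v K ih =>
    obtain ⟨h, hh⟩ := ih
    obtain ⟨l, hl⟩ := hA.translate_mem f v
    refine ⟨h - l * h, fun x => ?_⟩
    rw [toFun_sub, toFun_mul, hl, hh, translateProd_cons]
    ring

variable [IsTopologicalGroup G] [LocallyCompactSpace G] [T2Space G] [BorelSpace G]
  [μ.IsHaarMeasure]

/-- Near every point of the group there is a function of the algebra with a nonzero integral. -/
lemma IsConvolutionFunctionAlgebra.exists_integral_ne_zero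
    (hA : IsConvolutionFunctionAlgebra μ e) (hM : ConditionM A) {z : G} {V : Set G}
    (hV : V ∈ 𝓝 z) :
    ∃ g : A, (∀ x, toFun e g x ≠ 0 → x ∈ V) ∧ ∫ r, toFun e g (r⁻¹ * z) ∂μ ≠ 0 := by
  obtain ⟨k, hk, hkV, hkc⟩ := local_compact_nhds hV
  obtain ⟨f, hf1, hfk⟩ := exists_toFun_local_unit hM e hk
  have hfs : HasCompactSupport (toFun e f) := hkc.of_isClosed_subset (isClosed_tsupport _) hfk
  have hc1 : ∀ᶠ x in 𝓝 (1 : G), toFun e f (x * z) = 1 := by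
    have : Tendsto (fun x : G => x * z) (𝓝 1) (𝓝 z) := by
      have := (continuous_mul_const z).tendsto (1 : G)
      rwa [one_mul] at this
    exact this.eventually hf1
  obtain ⟨K, hK⟩ := exists_integral_translateProd_ne_zero (μ := μ)
    (c := fun x => toFun e f (x * z)) ((continuous_toFun e f).comp (by fun_prop))
    (hfs.comp_homeomorph (Homeomorph.mulRight z)) hc1
  obtain ⟨g, hg⟩ := hA.exists_mul_translateProd f K
  refine ⟨g, fun x hx => ?_, ?_⟩
  · rw [hg] at hx
    exact hkV (hfk (subset_tsupport _ (left_ne_zero_of_mul hx)))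
  · convert hK using 3 with r
    rw [hg]
    simp only [translateProd, mul_assoc]

/-- Near every two points there are functions in the algebra whose convolution product does not
vanish at the product of the points. -/
lemma IsConvolutionFunctionAlgebra.exists_conv_ne_zero
    (hA : IsConvolutionFunctionAlgebra μ e) (hM : ConditionM A) {y z : G} {U V : Set G}
    (hU : U ∈ 𝓝 y) (hV : V ∈ 𝓝 z) :
    ∃ f g : A, (∀ x, toFun e f x ≠ 0 → x ∈ U) ∧ (∀ x, toFun e g x ≠ 0 → x ∈ V) ∧
      conv μ (toFun e f) (toFun e g) (y * z) ≠ 0 := by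
  obtain ⟨f, hf1, hfU⟩ := exists_toFun_local_unit hM e hU
  -- `g` is taken so close to `z` that `f = 1` at every `s` with `s⁻¹ * (y * z)` in the cozero set
  -- of `g`; the convolution at `y * z` then reduces to an integral of `g` alone.
  have hV' : ∀ᶠ x in 𝓝 z, x ∈ V ∧ toFun e f (y * z * x⁻¹) = 1 := by
    have : Tendsto (fun x : G => y * z * x⁻¹) (𝓝 z) (𝓝 y) := by
      have := (by fun_prop : Continuous fun x : G => y * z * x⁻¹).tendsto z
      rwa [mul_inv_cancel_right] at this
    exact (show ∀ᶠ x in 𝓝 z, x ∈ V from hV).and (this.eventually hf1)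
  obtain ⟨g, hgV, hg⟩ := hA.exists_integral_ne_zero hM hV'
  refine ⟨f, g, fun x hx => hfU (subset_tsupport _ hx), fun x hx => (hgV x hx).1, ?_⟩
  have e1 : conv μ (toFun e f) (toFun e g) (y * z) = ∫ s, toFun e g (s⁻¹ * (y * z)) ∂μ := by
    refine integral_congr_ae (ae_of_all _ fun s => ?_)
    show toFun e f s * toFun e g (s⁻¹ * (y * z)) = toFun e g (s⁻¹ * (y * z))
    by_cases h : toFun e g (s⁻¹ * (y * z)) = 0
    · rw [h, mul_zero]
    · have := (hgV _ h).2
      rw [show y * z * (s⁻¹ * (y * z))⁻¹ = s by group] at this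
      rw [this, one_mul]
  rw [e1, ← integral_mul_left_eq_self (μ := μ) _ y]
  convert hg using 3 with r
  congr 1
  group

end Multiplicativity

/-! ### Multiplicativity of the support map -/

section SupportMap

variable {G₁ G₂ A₁ A₂ : Type*} [Group G₁] [TopologicalSpace G₁] [IsTopologicalGroup G₁]
  [T2Space G₁] [MeasurableSpace G₁]
  [Group G₂] [TopologicalSpace G₂] [IsTopologicalGroup G₂] [LocallyCompactSpace G₂]
  [T2Space G₂] [MeasurableSpace G₂] [BorelSpace G₂]
  [NonUnitalNormedCommRing A₁] [NormedSpace ℂ A₁] [NonUnitalNormedCommRing A₂] [NormedSpace ℂ A₂]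
  {μ₁ : Measure G₁} {μ₂ : Measure G₂} [μ₂.IsHaarMeasure]
  {e₁ : G₁ ≃ₜ characterSpace ℂ A₁} {e₂ : G₂ ≃ₜ characterSpace ℂ A₂} {T : A₁ →ₗ[ℂ] A₂}

/-- A weighted composition operator with condition (P) is given by a multiplicative map. -/
theorem ConditionP.map_mul (hP : ConditionP μ₁ μ₂ e₁ e₂ T)
    (hA₁ : IsConvolutionFunctionAlgebra μ₁ e₁) (hA₂ : IsConvolutionFunctionAlgebra μ₂ e₂)
    (hM₂ : ConditionM A₂) (hT : Function.Surjective T) {t : G₂ ≃ₜ G₁}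
    (ht : ∀ y, ∃ w : ℂ, w ≠ 0 ∧ ∀ a, toFun e₂ (T a) y = w * toFun e₁ a (t y)) (y z : G₂) :
    t (y * z) = t y * t z := by
  by_contra hne
  have hnhds : {p : G₁ × G₁ | p.1 * p.2 ≠ t (y * z)} ∈ 𝓝 (t y, t z) :=
    (isOpen_ne_fun continuous_mul continuous_const).mem_nhds (Ne.symm hne)
  obtain ⟨U, hU, V, hV, hUV⟩ := mem_nhds_prod_iff.1 hnhds
  obtain ⟨F, H, hF, hH, hFH⟩ := hA₂.exists_conv_ne_zero hM₂
    (t.continuous.continuousAt.preimage_mem_nhds hU)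
    (t.continuous.continuousAt.preimage_mem_nhds hV)
  obtain ⟨f, rfl⟩ := hT F
  obtain ⟨g, rfl⟩ := hT H
  have hcoz : ∀ (a : A₁) (W : Set G₁), (∀ x, toFun e₂ (T a) x ≠ 0 → x ∈ t ⁻¹' W) →
      ∀ x, toFun e₁ a x ≠ 0 → x ∈ W := by
    intro a W h x hx
    have := h (t.symm x) (by
      obtain ⟨w, hw, hwa⟩ := ht (t.symm x)
      rw [hwa, t.apply_symm_apply]
      exact mul_ne_zero hw hx)
    rwa [Set.mem_preimage, t.apply_symm_apply] at this
  obtain ⟨h, hh⟩ := hA₁.conv_mem f g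
  refine hFH (hP f g h hh (y * z) ?_)
  obtain ⟨w, -, hwa⟩ := ht (y * z)
  rw [hwa, hh, conv]
  -- A nonzero integrand would write `t (y * z)` as a product of a point of `U` and a point of `V`.
  have : ∀ s, toFun e₁ f s * toFun e₁ g (s⁻¹ * t (y * z)) = 0 := by
    intro s
    by_contra hs
    refine hUV (Set.mk_mem_prod (hcoz f U hF s (left_ne_zero_of_mul hs))
      (hcoz g V hH _ (right_ne_zero_of_mul hs))) ?_
    exact mul_inv_cancel_left s _
  simp only [this, integral_zero, mul_zero]

end SupportMap

end SepMaps

theorem theoremt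
    {G₁ G₂ A₁ A₂ : Type*}
    [Group G₁] [TopologicalSpace G₁] [IsTopologicalGroup G₁] [LocallyCompactSpace G₁]
    [T2Space G₁] [MeasurableSpace G₁] [BorelSpace G₁]
    [Group G₂] [TopologicalSpace G₂] [IsTopologicalGroup G₂] [LocallyCompactSpace G₂]
    [T2Space G₂] [MeasurableSpace G₂] [BorelSpace G₂]
    (μ₁ : MeasureTheory.Measure G₁) [μ₁.IsHaarMeasure] [μ₁.Regular]
    (μ₂ : MeasureTheory.Measure G₂) [μ₂.IsHaarMeasure] [μ₂.Regular]
    [NonUnitalNormedCommRing A₁] [NormedSpace ℂ A₁] [IsScalarTower ℂ A₁ A₁]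
    [SMulCommClass ℂ A₁ A₁] [CompleteSpace A₁]
    [NonUnitalNormedCommRing A₂] [NormedSpace ℂ A₂] [IsScalarTower ℂ A₂ A₂]
    [SMulCommClass ℂ A₂ A₂] [CompleteSpace A₂]
    (e₁ : G₁ ≃ₜ WeakDual.characterSpace ℂ A₁) (e₂ : G₂ ≃ₜ WeakDual.characterSpace ℂ A₂)
    (hA₁ : SepMaps.IsConvolutionFunctionAlgebra μ₁ e₁)
    (hA₂ : SepMaps.IsConvolutionFunctionAlgebra μ₂ e₂)
    (hM₁ : SepMaps.ConditionM A₁) (hM₂ : SepMaps.ConditionM A₂)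
    (T : A₁ →ₗ[ℂ] A₂) (hbij : Function.Bijective T) (hsep : SepMaps.IsSeparating T)
    (hP : SepMaps.ConditionP μ₁ μ₂ e₁ e₂ T) :
    ∃ t : G₂ ≃ₜ* G₁, ∀ y : G₂,
      e₂ y ∈ SepMaps.supportMapDomain T ∧
      SepMaps.functionalSupport T (e₂ y) =
        {((e₁ (t y) : WeakDual.characterSpace ℂ A₁) :
          OnePoint (WeakDual.characterSpace ℂ A₁))} := by
  -- Local compactness of the character spaces makes their one-point compactifications Hausdorff.
  have : LocallyCompactSpace (WeakDual.characterSpace ℂ A₁) :=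
    e₁.symm.isClosedEmbedding.locallyCompactSpace
  have : LocallyCompactSpace (WeakDual.characterSpace ℂ A₂) :=
    e₂.symm.isClosedEmbedding.locallyCompactSpace
  obtain ⟨t, ht⟩ := SepMaps.exists_supportMap_homeomorph hA₁.regularTauberian hM₁
    hA₂.regularTauberian hM₂ hbij hsep
  set t' : G₂ ≃ₜ G₁ := (e₂.trans t).trans e₁.symm with ht'
  have het : ∀ y, e₁ (t' y) = t (e₂ y) := fun y => e₁.apply_symm_apply _
  have hmul := hP.map_mul hA₁ hA₂ hM₂ hbij.2 (t := t') fun y => by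
    obtain ⟨w, hw, hwa⟩ := (ht (e₂ y)).2.2
    refine ⟨w, hw, fun a => ?_⟩
    rw [SepMaps.toFun, SepMaps.toFun, het]
    exact hwa a
  refine ⟨{ t' with map_mul' := hmul }, fun y => ⟨(ht (e₂ y)).1, ?_⟩⟩
  rw [(ht (e₂ y)).2.1, ← het]
  rfl
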